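/- Conventions. Let $U$ be a universal prefix-free machine (a partial computable function on finite binary strings with prefix-free domain which simulates every other such function with programs longer by at most an additive constant), let $\mathrm K(\sigma)=\min\{|\tau| : U(\tau)=\sigma\}$, let $\Omega=\sum_{U(\sigma)\downarrow}2^{-|\sigma|}$, identified with the infinite sequence of its binary digits, and let $\langle\cdot,\cdot\rangle$ be a computable bijection from pairs of strings to strings. For strings put $\mathbf I(\sigma:\tau)=\mathrm K(\sigma)+\mathrm K(\tau)-\mathrm K(\langle\sigma,\tau\rangle)$. A discrete semi-measure is a function $m\ge 0$ on strings with $\sum_\sigma m(\sigma)\le 1$. Let $\mathbf m$ be a universal lower semi-computable discrete semi-measure (one that dominates each such semi-measure up to a multiplicative constant), and for $X\in 2^{\mathbb N}$ let $\mathbf m^X$ be a universal discrete semi-measure among those lower semi-computable relative to the oracle $X$. For sequences $X,Y$, the quantity $\mathbf I(X:Y)\in[-\infty,\infty]$ is defined by $2^{\mathbf I(X:Y)}=\sum_{\sigma,\tau}\mathbf m^X(\sigma)\,\mathbf m^Y(\tau)\,2^{\mathbf I(\sigma:\tau)}$. Write $X{\upharpoonright}n$ for the string of the first $n$ bits of $X$.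 Theorem. Let $\mathcal C\subseteq 2^{\mathbb N}$ be a $\Pi^0_1$ class, let $T$ be the set of all prefixes of members of $\mathcal C$ (its canonical co-c.e. tree), and let $T_k$ be the set of strings of length $k$ in $T$. Suppose that $\mathcal C$ is deep, witnessed by a computable, non-decreasing and unbounded function $f:\mathbb N\to\mathbb N$ such that $\mathbf m(T_{f(n)})=\sum_{\sigma\in T_{f(n)}}\mathbf m(\sigma)<2^{-n}$ for all $n$. Then there is a constant $c$ such that for every $Y\in\mathcal C$ and all $n$, $$\mathbf I\big(\Omega{\upharpoonright}n : Y{\upharpoonright}f(n)\big)\ \ge\ n-c\log_2(n+2).$$ In particular, $\mathbf I(\Omega:Y)=\infty$ for every $Y\in\mathcal C$. -/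

import Mathlib

open scoped ENNReal NNReal Topology

noncomputable section

namespace AlgInfo

/-! ### Cantor space, trees and effectively closed classes -/

/-- `X ↾ n`: the string of the first `n` bits of the sequence `X`. -/
def restrict (X : ℕ → Bool) (n : ℕ) : List Bool :=
  (List.range n).map X

/-- `σ ≺ X`: the string `σ` is a prefix of the sequence `X`. -/
def IsInitial (σ : List Bool) (X : ℕ → Bool) : Prop :=
  restrict X σ.length = σ

/-- A `Π⁰₁` class: the complement of the union of the cylinders of a c.e. set of strings. -/
def IsPi01 (C : Set (ℕ → Bool)) : Prop :=
  ∃ S : List Bool → Prop, REPred S ∧ Cᶜ = {X | ∃ σ, S σ ∧ IsInitial σ X}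

/-- The canonical co-c.e. tree of a class: the set of all prefixes of its members. -/
def canonicalTree (C : Set (ℕ → Bool)) : Set (List Bool) :=
  {σ | ∃ X ∈ C, IsInitial σ X}

/-- `T_n`: the set of the members of `T` of length `n`. -/
def level (T : Set (List Bool)) (n : ℕ) : Set (List Bool) :=
  {σ | σ ∈ T ∧ σ.length = n}

/-- Order functions: non-decreasing and unbounded. -/
def IsOrder (f : ℕ → ℕ) : Prop :=
  Monotone f ∧ ∀ k, ∃ n, k ≤ f n

/-! ### Lower semi-computable discrete semi-measures, relative to oracles

The set `O` is a set of oracles; `O = ∅` gives the unrelativized notions, see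
`computableIn_empty_iff`. -/

theorem computableIn_empty_iff {α σ : Type*} [Primcodable α] [Primcodable σ] {f : α → σ} :
    ComputableIn ∅ f ↔ Computable f :=
  ⟨fun h => Nat.RecursiveIn.partrec_of_oracle (by simp) h, Computable.computableIn⟩

/-- The oracle given by a sequence. -/
def oracle (X : ℕ → Bool) : Set (ℕ →. ℕ) :=
  {fun n => Part.some (X n).toNat}

/-- The non-negative dyadic rational `a / 2 ^ k` coded by the pair `(a, k)`. -/
def dyadic (q : ℕ × ℕ) : ℝ≥0∞ :=
  (q.1 : ℝ≥0∞) / 2 ^ q.2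

/-- `m` is the limit of a non-decreasing `O`-computable sequence of dyadic-valued functions. -/
def LowerSemicomputableIn (O : Set (ℕ →. ℕ)) (m : List Bool → ℝ≥0∞) : Prop :=
  ∃ a : List Bool → ℕ → ℕ × ℕ, ComputableIn₂ O a ∧
    ∀ σ, Monotone (fun i => dyadic (a σ i)) ∧
      Filter.Tendsto (fun i => dyadic (a σ i)) Filter.atTop (𝓝 (m σ))

/-- An `O`-lower semi-computable discrete semi-measure. -/
def IsSemimeasureIn (O : Set (ℕ →. ℕ)) (m : List Bool → ℝ≥0∞) : Prop :=
  ∑' σ, m σ ≤ 1 ∧ LowerSemicomputableIn O m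

/-- A universal `O`-lower semi-computable discrete semi-measure. -/
def IsUniversalSemimeasureIn (O : Set (ℕ →. ℕ)) (m : List Bool → ℝ≥0∞) : Prop :=
  IsSemimeasureIn O m ∧
    ∀ m', IsSemimeasureIn O m' → ∃ c : ℝ≥0, ∀ σ, m' σ ≤ c * m σ

/-- `m(S) = ∑_{σ ∈ S} m(σ)`. -/
def weight (m : List Bool → ℝ≥0∞) (S : Set (List Bool)) : ℝ≥0∞ :=
  ∑' σ : S, m σ

/-! ### Prefix-free machines and Kolmogorov complexity -/

/-- A prefix-free machine: a partial computable function on strings with prefix-free domain. -/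
def IsPrefixFreeMachine (U : List Bool →. List Bool) : Prop :=
  Partrec U ∧ ∀ σ τ, (U σ).Dom → (U τ).Dom → σ <+: τ → σ = τ

/-- A universal prefix-free machine: it simulates every prefix-free machine with programs longer
by at most an additive constant. Machines `U` such that every prefix-free `M` has a coding string
`ρ` with `U (ρ ++ τ) = M τ` for all `τ` are a special case. -/
def IsUniversalMachine (U : List Bool →. List Bool) : Prop :=
  IsPrefixFreeMachine U ∧
    ∀ M, IsPrefixFreeMachine M →
      ∃ c : ℕ, ∀ τ σ, σ ∈ M τ → ∃ τ', σ ∈ U τ' ∧ τ'.length ≤ τ.length + c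

/-- Prefix-free Kolmogorov complexity (the minimum exists if `U` is universal). -/
def K (U : List Bool →. List Bool) (σ : List Bool) : ℕ :=
  sInf {n | ∃ τ : List Bool, τ.length = n ∧ σ ∈ U τ}

/-- The halting probability of the machine `U`. -/
def omegaReal (U : List Bool →. List Bool) : ℝ :=
  ∑' σ : {σ : List Bool // (U σ).Dom}, (2 : ℝ)⁻¹ ^ σ.1.length

/-- Chaitin's `Ω` as a sequence: the binary expansion of the halting probability. -/
def omega (U : List Bool →. List Bool) (n : ℕ) : Bool :=
  decide (Real.digits (omegaReal U) 2 n = 1)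

/-! ### Mutual information -/

/-- `I(σ : τ) = K(σ) + K(τ) - K(σ, τ)`, where `K(σ, τ)` is the complexity of the string that codes
the pair. -/
def mutualInfo (U : List Bool →. List Bool) (pair : List Bool × List Bool ≃ List Bool)
    (σ τ : List Bool) : ℤ :=
  (K U σ : ℤ) + K U τ - K U (pair (σ, τ))

/-- Mutual information of two sequences `X` and `Y`, where `mX` and `mY` are the universal
semi-measures relative to `X` and `Y`: the binary logarithm of
`∑_{σ, τ} mX(σ) * mY(τ) * 2 ^ I(σ : τ)`. -/
def mutualInfoSeq (U : List Bool →. List Bool) (pair : List Bool × List Bool ≃ List Bool)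
    (mX mY : List Bool → ℝ≥0∞) : EReal :=
  ENNReal.log (∑' p : List Bool × List Bool,
    mX p.1 * mY p.2 * (2 : ℝ≥0∞) ^ mutualInfo U pair p.1 p.2) / (Real.log 2 : ℝ)

end AlgInfo

end

open scoped ENNReal NNReal Topology

noncomputable section

namespace AlgInfo

/-!
The first `n` bits of `Ω` determine a stage by which all but about `2 ^ (-n)` of the halting
probability of `U` has been exhausted. By depth and the coding theorem the programs for strings in
the co-c.e. set `T_{f(n)}` have weight `O(2 ^ (-n))`, so a good stage can be found at which moreover
the programs seen so far for the strings not yet excluded from `T_{f(n)}` have weight `O(2 ^ (-n))`.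
The programs still to come have weight `O(2 ^ (-n))`, too. This bounds the programs for a superset
of `T_{f(n)}` that is c.e. given `Ω ↾ n`, and the Kraft–Chaitin theorem turns a program for `Ω ↾ n`
and one for `τ ∈ T_{f(n)}` into a description of the pair that is `n - O(1)` bits shorter than the
two together.

For the second part, `m^X` gives `X ↾ g j` weight at least a constant times `2 ^ (-j)`. Along a
subsequence on which the mutual information of the prefixes exceeds `3 j`, the terms of the series
for the mutual information of `Ω` and `Y` are therefore unbounded.
-/

/-! ### Binary values of strings -/

/-- The natural number with the given binary expansion, most significant bit first, so that the
binary fraction `0.x` is `binVal x / 2 ^ |x|`. -/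
def binVal (l : List Bool) : ℕ :=
  l.foldl (fun a b => 2 * a + b.toNat) 0

theorem binVal_nil : binVal [] = 0 := rfl

theorem binVal_concat (l : List Bool) (b : Bool) :
    binVal (l ++ [b]) = 2 * binVal l + b.toNat := by
  simp [binVal]

theorem binVal_append (l l' : List Bool) :
    binVal (l ++ l') = binVal l * 2 ^ l'.length + binVal l' := by
  induction l' using List.reverseRecOn with
  | nil => simp [binVal_nil]
  | append_singleton l' b ih =>
    rw [← List.append_assoc, binVal_concat, ih, binVal_concat, List.length_append,
      List.length_singleton, pow_succ]
    ring

theorem binVal_lt_two_pow_length (l : List Bool) : binVal l < 2 ^ l.length := by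
  induction l using List.reverseRecOn with
  | nil => simp [binVal_nil]
  | append_singleton l b ih =>
    rw [binVal_concat, List.length_append, List.length_singleton, pow_succ]
    have := Bool.toNat_le b
    omega

theorem exists_length_eq_binVal_eq {n j : ℕ} (h : j < 2 ^ n) :
    ∃ l : List Bool, l.length = n ∧ binVal l = j := by
  induction n generalizing j with
  | zero => exact ⟨[], rfl, by rw [binVal_nil]; omega⟩
  | succ n ih =>
    obtain ⟨l, hl, hj⟩ := ih (j := j / 2) (by omega)
    refine ⟨l ++ [decide (j % 2 = 1)], by simp [hl], ?_⟩
    rw [binVal_concat, hj]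
    rcases Nat.mod_two_eq_zero_or_one j with h | h <;> simp [h] <;> omega

theorem primrec_binVal : Primrec binVal :=
  Primrec.list_foldl (h := fun _ (p : ℕ × Bool) => 2 * p.1 + p.2.toNat) Primrec.id (Primrec.const 0)
    (Primrec.nat_add.comp (Primrec.nat_double.comp (Primrec.fst.comp Primrec.snd))
      ((Primrec.dom_bool Bool.toNat).comp (Primrec.snd.comp Primrec.snd))).to₂

theorem length_restrict (X : ℕ → Bool) (n : ℕ) : (restrict X n).length = n := by
  simp [restrict]

theorem restrict_succ (X : ℕ → Bool) (n : ℕ) : restrict X (n + 1) = restrict X n ++ [X n] := by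
  simp [restrict, List.range_succ]

theorem floor_mul_two_pow (x : ℝ) (n : ℕ) :
    ⌊x * 2 ^ n⌋₊ =
      ⌊x⌋₊ * 2 ^ n + binVal (restrict (fun i => decide (Real.digits x 2 i = 1)) n) := by
  induction n with
  | zero => simp [restrict, binVal_nil]
  | succ n ih =>
    have hdiv : ⌊x * 2 ^ (n + 1)⌋₊ / 2 = ⌊x * 2 ^ n⌋₊ := by
      rw [← Nat.floor_div_ofNat, pow_succ, ← mul_assoc, mul_div_cancel_right₀ _ (by simp)]
    have hmod : (decide (Real.digits x 2 n = 1)).toNat = ⌊x * 2 ^ (n + 1)⌋₊ % 2 := by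
      have hdigit : (Real.digits x 2 n : ℕ) = ⌊x * 2 ^ (n + 1)⌋₊ % 2 := by simp [Real.digits]
      rw [← hdigit]
      generalize Real.digits x 2 n = d
      fin_cases d <;> rfl
    rw [← Nat.div_add_mod ⌊x * 2 ^ (n + 1)⌋₊ 2, hdiv, ih, ← hmod, restrict_succ, binVal_concat]
    ring

/-! ### Dyadic rationals -/

theorem primrec_two_pow : Primrec fun n : ℕ => 2 ^ n :=
  (Primrec₂.unpaired'.1 Nat.Primrec.pow).comp (Primrec.const 2) Primrec.id

theorem dyadic_eq_ofReal (p : ℕ × ℕ) : dyadic p = ENNReal.ofReal ((p.1 : ℝ) / 2 ^ p.2) := by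
  rw [dyadic, ENNReal.ofReal_div_of_pos (by positivity), ENNReal.ofReal_natCast,
    ENNReal.ofReal_pow (by norm_num), ENNReal.ofReal_ofNat]

theorem dyadic_mk (k n : ℕ) : dyadic (k, n) = k * 2⁻¹ ^ n := by
  rw [dyadic, div_eq_mul_inv, ENNReal.inv_pow]

theorem dyadic_zero : dyadic (0, 0) = 0 := by
  simp [dyadic]

theorem dyadic_one (n : ℕ) : dyadic (1, n) = 2⁻¹ ^ n := by
  rw [dyadic_mk, Nat.cast_one, one_mul]

theorem dyadic_le_dyadic_iff (p q : ℕ × ℕ) :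
    dyadic p ≤ dyadic q ↔ p.1 * 2 ^ q.2 ≤ q.1 * 2 ^ p.2 := by
  rw [dyadic_eq_ofReal, dyadic_eq_ofReal, ENNReal.ofReal_le_ofReal_iff (by positivity),
    div_le_div_iff₀ (by positivity) (by positivity)]
  norm_cast

theorem primrecRel_dyadic_le : PrimrecRel fun p q : ℕ × ℕ => dyadic p ≤ dyadic q := by
  have cross : Primrec₂ fun p q : ℕ × ℕ => p.1 * 2 ^ q.2 :=
    Primrec.nat_mul.comp (Primrec.fst.comp Primrec.fst)
      (primrec_two_pow.comp (Primrec.snd.comp Primrec.snd))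
  exact (Primrec.nat_le.comp cross (cross.comp Primrec.snd Primrec.fst)).of_eq
    fun x => (dyadic_le_dyadic_iff x.1 x.2).symm

/-- The sum of two coded dyadic rationals, not reduced to lowest terms. -/
def dyadicAdd (p q : ℕ × ℕ) : ℕ × ℕ :=
  (p.1 * 2 ^ q.2 + q.1 * 2 ^ p.2, p.2 + q.2)

theorem dyadic_dyadicAdd (p q : ℕ × ℕ) : dyadic (dyadicAdd p q) = dyadic p + dyadic q := by
  rw [dyadic_eq_ofReal, dyadic_eq_ofReal, dyadic_eq_ofReal,
    ← ENNReal.ofReal_add (by positivity) (by positivity), dyadicAdd]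
  congr 1
  push_cast
  rw [pow_add]
  field_simp

theorem primrec_dyadicAdd : Primrec₂ dyadicAdd := by
  have cross : Primrec₂ fun p q : ℕ × ℕ => p.1 * 2 ^ q.2 :=
    Primrec.nat_mul.comp (Primrec.fst.comp Primrec.fst)
      (primrec_two_pow.comp (Primrec.snd.comp Primrec.snd))
  exact Primrec.pair (Primrec.nat_add.comp cross (cross.comp Primrec.snd Primrec.fst))
    (Primrec.nat_add.comp (Primrec.snd.comp Primrec.fst) (Primrec.snd.comp Primrec.snd))

/-- The sum of the first `n` terms of a sequence of coded dyadic rationals. -/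
def dyadicSum (w : ℕ → ℕ × ℕ) (n : ℕ) : ℕ × ℕ :=
  Nat.rec (0, 0) (fun i s => dyadicAdd s (w i)) n

theorem dyadic_dyadicSum (w : ℕ → ℕ × ℕ) (n : ℕ) :
    dyadic (dyadicSum w n) = ∑ i ∈ Finset.range n, dyadic (w i) := by
  induction n with
  | zero => exact dyadic_zero
  | succ n ih => rw [Finset.sum_range_succ, ← ih, ← dyadic_dyadicAdd]; rfl

theorem monotone_dyadic_dyadicSum (w : ℕ → ℕ × ℕ) : Monotone fun n => dyadic (dyadicSum w n) := by
  simp only [dyadic_dyadicSum]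
  exact fun _ _ h => Finset.sum_le_sum_of_subset (Finset.range_mono h)

theorem tendsto_dyadic_dyadicSum (w : ℕ → ℕ × ℕ) :
    Filter.Tendsto (fun n => dyadic (dyadicSum w n)) Filter.atTop (𝓝 (∑' i, dyadic (w i))) := by
  simp only [dyadic_dyadicSum]
  exact ENNReal.tendsto_nat_tsum _

theorem dyadic_dyadicSum_le_tsum (w : ℕ → ℕ × ℕ) (n : ℕ) :
    dyadic (dyadicSum w n) ≤ ∑' i, dyadic (w i) := by
  rw [dyadic_dyadicSum]
  exact ENNReal.sum_le_tsum _

theorem primrec_dyadicSum {α : Type*} [Primcodable α] {w : α → ℕ → ℕ × ℕ} (hw : Primrec₂ w) :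
    Primrec₂ fun a n => dyadicSum (w a) n :=
  Primrec.nat_rec (Primrec.const (0, 0))
    (primrec_dyadicAdd.comp (Primrec.snd.comp Primrec.snd)
      (hw.comp Primrec.fst (Primrec.fst.comp Primrec.snd))).to₂

theorem computable_dyadicSum {α : Type*} [Primcodable α] {w : α → ℕ → ℕ × ℕ}
    (hw : Computable₂ w) : Computable₂ fun a n => dyadicSum (w a) n :=
  Computable.nat_rec Computable.snd (Computable.const (0, 0))
    (primrec_dyadicAdd.to_comp.comp (Computable.snd.comp Computable.snd)
      (hw.comp (Computable.fst.comp Computable.fst) (Computable.fst.comp Computable.snd))).to₂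

/-! ### Kraft's inequality for prefix-free sets -/

theorem uniquelyDecodable_of_prefixFree {α : Type*} {S : Set (List α)} (hnil : [] ∉ S)
    (hS : ∀ σ ∈ S, ∀ τ ∈ S, σ <+: τ → σ = τ) : InformationTheory.UniquelyDecodable S := by
  intro L₁
  induction L₁ with
  | nil =>
    rintro (_ | ⟨x, L₂⟩) - h₂ heq
    · rfl
    · obtain ⟨rfl, -⟩ := List.append_eq_nil_iff.1 heq.symm
      exact absurd (h₂ [] List.mem_cons_self) hnil
  | cons y L₁ ih =>
    rintro (_ | ⟨x, L₂⟩) h₁ h₂ heq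
    · obtain ⟨rfl, -⟩ := List.append_eq_nil_iff.1 heq
      exact absurd (h₁ [] List.mem_cons_self) hnil
    · rw [List.forall_mem_cons] at h₁ h₂
      simp only [List.flatten_cons] at heq
      obtain rfl : y = x := by
        rcases List.append_eq_append_iff.1 heq with ⟨z, hz, -⟩ | ⟨z, hz, -⟩
        · exact hS _ h₁.1 _ h₂.1 ⟨z, hz.symm⟩
        · exact (hS _ h₂.1 _ h₁.1 ⟨z, hz.symm⟩).symm
      rw [ih L₂ h₁.2 h₂.2 (List.append_cancel_left heq)]

theorem kraft_inequality_of_prefixFree {s : Finset (List Bool)}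
    (hs : ∀ σ ∈ s, ∀ τ ∈ s, σ <+: τ → σ = τ) : ∑ σ ∈ s, (2 : ℝ)⁻¹ ^ σ.length ≤ 1 := by
  by_cases hnil : [] ∈ s
  · have hsingle : s = {[]} := Finset.eq_singleton_iff_unique_mem.2
      ⟨hnil, fun τ hτ => (hs _ hnil _ hτ List.nil_prefix).symm⟩
    simp [hsingle]
  · simpa using InformationTheory.kraft_mcmillan_inequality
      (uniquelyDecodable_of_prefixFree (S := (s : Set (List Bool))) (by simpa using hnil) hs)

/-! ### Stages of partial computations -/

section Stages

variable {α β : Type*} [Primcodable α] [Primcodable β]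

open Nat.Partrec (Code) in
theorem exists_primrec_stages {g : α →. β} (hg : Partrec g) :
    ∃ h : α → ℕ → Option β, Primrec₂ h ∧ (∀ a b, Monotone fun s => b ∈ h a s) ∧
      ∀ a b, b ∈ g a ↔ ∃ s, b ∈ h a s := by
  obtain ⟨c, hc⟩ := Code.exists_code.1 (Partrec.bind_decode₂_iff.1 hg)
  have heval (a : α) : c.eval (Encodable.encode a) = (g a).map Encodable.encode := by
    simp [hc]
  refine ⟨fun a s => (Code.evaln s c (Encodable.encode a)).bind Encodable.decode, ?_, ?_, ?_⟩
  · exact Primrec.option_bind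
      (Code.primrec_evaln.comp (Primrec.pair (Primrec.pair Primrec.snd (Primrec.const c))
        (Primrec.encode.comp Primrec.fst)))
      (Primrec.decode.comp Primrec.snd).to₂
  · intro a b s t hst hb
    obtain ⟨y, hy, hyb⟩ := Option.bind_eq_some_iff.1 hb
    exact Option.bind_eq_some_iff.2 ⟨y, Code.evaln_mono hst hy, hyb⟩
  · intro a b
    constructor
    · intro hb
      obtain ⟨s, hs⟩ := Code.evaln_complete.1 (heval a ▸ Part.mem_map Encodable.encode hb)
      exact ⟨s, Option.bind_eq_some_iff.2 ⟨_, hs, Encodable.encodek b⟩⟩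
    · rintro ⟨s, hs⟩
      obtain ⟨y, hy, hyb⟩ := Option.bind_eq_some_iff.1 hs
      have hmem := Code.evaln_sound hy
      rw [heval] at hmem
      obtain ⟨b', hb', rfl⟩ := (Part.mem_map_iff _).1 hmem
      rw [Encodable.encodek, Option.some_inj] at hyb
      exact hyb ▸ hb'

theorem exists_primrecRel_stages {p : α → Prop} (hp : REPred p) :
    ∃ R : α → ℕ → Prop, PrimrecRel R ∧ (∀ a, Monotone (R a)) ∧ ∀ a, p a ↔ ∃ s, R a s := by
  obtain ⟨h, hprim, hmono, hh⟩ := exists_primrec_stages hp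
  refine ⟨fun a s => () ∈ h a s, Primrec.eq.comp hprim (Primrec.const (some ())),
    fun a => hmono a (), fun a => ?_⟩
  rw [← hh]
  simp

open Classical in
theorem rePred_exists {R : α → ℕ → Prop} (hR : ComputablePred fun x : α × ℕ => R x.1 x.2) :
    REPred fun a => ∃ s, R a s := by
  have hstep : Computable₂ fun a s => bif decide (R a s) then some () else none :=
    Computable.cond hR.decide (Computable.const _) (Computable.const _)
  refine (Partrec.rfindOpt hstep).dom_re.of_eq fun a => Nat.rfindOpt_dom.trans ?_
  simp [Bool.cond_decide]

theorem primrecRel_isLeast {R : α → ℕ → Prop} (hR : PrimrecRel R) :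
    PrimrecRel fun a u => IsLeast {v | R a v} u := by
  have hbefore : PrimrecRel fun a u => ∀ v ∈ List.range u, ¬R a v :=
    (PrimrecRel.forall_mem_list (R := fun v a => ¬R a v)
      (hR.not.comp Primrec.snd Primrec.fst)).comp
        (Primrec.list_range.comp Primrec.snd) Primrec.fst
  refine (PrimrecPred.and hR hbefore).of_eq fun x => and_congr_right fun _ => ?_
  simp only [List.mem_range, mem_lowerBounds, Set.mem_ofPred_eq]
  exact forall_congr' fun v => by rw [← not_imp_not, not_not, not_lt]

open Classical in
theorem exists_primrec_injective_enumeration {g : α →. β} (hg : Partrec g) :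
    ∃ e : ℕ → Option (α × β), Primrec e ∧ (∀ a b, b ∈ g a ↔ ∃ i, e i = some (a, b)) ∧
      ∀ i j x, e i = some x → e j = some x → i = j := by
  obtain ⟨h, hprim, -, hh⟩ := exists_primrec_stages hg
  have hhalt : PrimrecRel fun a s => (h a s).isSome :=
    Primrec.eq.comp (Primrec.option_isSome.comp hprim) (Primrec.const true)
  let e (i : ℕ) : Option (α × β) := (Encodable.decode₂ (α × ℕ) i).bind fun x =>
    if IsLeast {s | (h x.1 s).isSome} x.2 then (h x.1 x.2).map (Prod.mk x.1) else none
  have he (i : ℕ) (a : α) (b : β) : e i = some (a, b) ↔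
      ∃ s, Encodable.encode (a, s) = i ∧ IsLeast {s | (h a s).isSome} s ∧ b ∈ h a s := by
    simp only [e, Option.bind_eq_some_iff, Encodable.decode₂_eq_some, Prod.exists,
      Option.ite_none_right_eq_some, Option.map_eq_some_iff, Prod.mk.injEq]
    constructor
    · rintro ⟨a, s, hi, hs, b, hb, rfl, rfl⟩
      exact ⟨s, hi, hs, hb⟩
    · rintro ⟨s, hi, hs, hb⟩
      exact ⟨a, s, hi, hs, b, hb, rfl, rfl⟩
  refine ⟨e, ?_, fun a b => ⟨fun hb => ?_, ?_⟩, ?_⟩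
  · refine Primrec.option_bind Primrec.decode₂ (Primrec₂.mk (Primrec.ite
      ((primrecRel_isLeast hhalt).comp (Primrec.fst.comp Primrec.snd)
        (Primrec.snd.comp Primrec.snd)) ?_ (Primrec.const none)))
    exact Primrec.option_map
      (hprim.comp (Primrec.fst.comp Primrec.snd) (Primrec.snd.comp Primrec.snd))
      (Primrec.pair (Primrec.fst.comp (Primrec.snd.comp Primrec.fst)) Primrec.snd)
  · obtain ⟨s, hs⟩ := (hh a b).1 hb
    have hne : ∃ s, (h a s).isSome := ⟨s, Option.isSome_of_mem hs⟩
    have hleast := Nat.isLeast_find hne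
    obtain ⟨b', hb'⟩ := Option.isSome_iff_exists.1 hleast.1
    obtain rfl := Part.mem_unique hb ((hh a b').2 ⟨_, hb'⟩)
    exact ⟨_, (he _ _ _).2 ⟨_, rfl, hleast, hb'⟩⟩
  · rintro ⟨i, hi⟩
    obtain ⟨s, -, -, hs⟩ := (he _ _ _).1 hi
    exact (hh a b).2 ⟨s, hs⟩
  · rintro i j ⟨a, b⟩ hi hj
    obtain ⟨s, rfl, hs, -⟩ := (he _ _ _).1 hi
    obtain ⟨t, rfl, ht, -⟩ := (he _ _ _).1 hj
    rw [hs.unique ht]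

end Stages

/-! ### The Kraft–Chaitin theorem -/

/-- A request `(l, σ)` asks for a description of the string `σ` of length `l`. -/
abbrev Request : Type :=
  ℕ × List Bool

/-- The weight `2 ^ (-l)` of a request `(l, σ)`, coded as a dyadic rational; an absent request has
weight `0`. -/
def requestWeight (o : Option Request) : ℕ × ℕ :=
  o.elim (0, 0) fun q => (1, q.1)

/-- The total weight of the requests with index less than `n`, coded as a dyadic rational. -/
def requestSum (r : ℕ → Option Request) (n : ℕ) : ℕ × ℕ :=
  dyadicSum (fun i => requestWeight (r i)) n

/-- The hypothesis of the Kraft–Chaitin theorem: a computable sequence of requests of total weight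
at most `1`. -/
structure IsBoundedRequestSequence (r : ℕ → Option Request) : Prop where
  computable : Computable r
  tsum_le_one : ∑' i, dyadic (requestWeight (r i)) ≤ 1

theorem dyadic_requestWeight_none : dyadic (requestWeight none) = 0 :=
  dyadic_zero

theorem dyadic_requestWeight_some (q : Request) : dyadic (requestWeight (some q)) = 2⁻¹ ^ q.1 :=
  dyadic_one q.1

theorem primrec_requestWeight : Primrec requestWeight :=
  (Primrec.option_casesOn (f := fun _ => (0, 0)) (g := fun _ (q : Request) => ((1 : ℕ), q.1))
    Primrec.id (Primrec.const (0, 0))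
    (Primrec.pair (Primrec.const 1) (Primrec.fst.comp Primrec.snd)).to₂).of_eq
    fun o => by cases o <;> rfl

theorem monotone_dyadic_requestSum (r : ℕ → Option Request) :
    Monotone fun n => dyadic (requestSum r n) :=
  monotone_dyadic_dyadicSum _

theorem dyadic_requestSum_succ (r : ℕ → Option Request) (i : ℕ) :
    dyadic (requestSum r (i + 1)) = dyadic (requestSum r i) + dyadic (requestWeight (r i)) :=
  dyadic_dyadicAdd _ _

/-- The dyadic interval `[0.x, 0.x + 2 ^ (-|x|)]` of the string `x` is contained in `[a, b]`. -/
def FitsIn (x : List Bool) (a b : ℝ≥0∞) : Prop :=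
  a ≤ dyadic (binVal x, x.length) ∧ dyadic (binVal x + 1, x.length) ≤ b

theorem FitsIn.append {x y : List Bool} {a b : ℝ≥0∞} (h : FitsIn x a b) :
    FitsIn (x ++ y) a b := by
  refine ⟨h.1.trans ?_, le_trans ?_ h.2⟩ <;>
    simp only [dyadic_le_dyadic_iff, binVal_append, List.length_append, pow_add, ← mul_assoc,
      mul_right_comm _ (2 ^ x.length)] <;>
    gcongr
  · exact Nat.le_add_right _ _
  · have := binVal_lt_two_pow_length y
    linarith

theorem FitsIn.lt {x : List Bool} {a b : ℝ≥0∞} (h : FitsIn x a b) : a < b := by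
  refine h.1.trans_lt (lt_of_lt_of_le (lt_of_not_ge ?_) h.2)
  simp [dyadic_le_dyadic_iff]

theorem FitsIn.index_unique {s : ℕ → ℝ≥0∞} (hs : Monotone s) {x : List Bool} {i j : ℕ}
    (hi : FitsIn x (s i) (s (i + 1))) (hj : FitsIn x (s j) (s (j + 1))) : i = j := by
  have hle {k l : ℕ} (hk : FitsIn x (s k) (s (k + 1))) (hl : FitsIn x (s l) (s (l + 1))) :
      k ≤ l := by
    have hlt : s k < s (l + 1) := FitsIn.lt ⟨hk.1, hl.2⟩
    exact Nat.lt_succ_iff.1 (hs.reflect_lt hlt)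
  exact le_antisymm (hle hi hj) (hle hj hi)

theorem exists_fitsIn {a : ℝ≥0∞} {l : ℕ} (ha : a + 2⁻¹ ^ l ≤ 1) :
    ∃ x : List Bool, x.length = l + 1 ∧ FitsIn x a (a + 2⁻¹ ^ l) := by
  lift a to ℝ≥0 using ne_top_of_le_ne_top ENNReal.one_ne_top (le_self_add.trans ha)
  have hadd : (a : ℝ≥0∞) + 2⁻¹ ^ l = ENNReal.ofReal (a + 2⁻¹ ^ l) := by
    rw [ENNReal.ofReal_add (by positivity) (by positivity), ENNReal.ofReal_coe_nnreal,
      ENNReal.ofReal_pow (by positivity), ENNReal.ofReal_inv_of_pos (by positivity),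
      ENNReal.ofReal_ofNat]
  rw [hadd, ENNReal.ofReal_le_one] at ha
  set v := ⌈a * 2 ^ (l + 1)⌉₊
  have hpos : (0 : ℝ) < 2 ^ (l + 1) := by positivity
  have hlow : (a : ℝ) * 2 ^ (l + 1) ≤ v := Nat.le_ceil (a * 2 ^ (l + 1))
  have hhigh : ((v : ℝ) + 1) / 2 ^ (l + 1) ≤ a + 2⁻¹ ^ l := by
    have hv : (v : ℝ) < a * 2 ^ (l + 1) + 1 := Nat.ceil_lt_add_one (a := a * 2 ^ (l + 1)) (by simp)
    have htwo : (2 : ℝ)⁻¹ ^ l * 2 ^ (l + 1) = 2 := by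
      rw [pow_succ, ← mul_assoc, ← mul_pow]
      norm_num
    rw [div_le_iff₀ hpos, add_mul, htwo]
    linarith
  have hlt : v < 2 ^ (l + 1) := by
    have hle := hhigh.trans ha
    rw [div_le_one hpos] at hle
    exact_mod_cast (lt_add_one _).trans_le hle
  obtain ⟨x, hx, hxv⟩ := exists_length_eq_binVal_eq hlt
  refine ⟨x, hx, ?_, ?_⟩
  · rw [dyadic_eq_ofReal, hx, hxv, ← ENNReal.ofReal_coe_nnreal]
    exact ENNReal.ofReal_le_ofReal ((le_div_iff₀ hpos).2 hlow)
  · rw [hadd, dyadic_eq_ofReal, hx, hxv]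
    push_cast
    exact ENNReal.ofReal_le_ofReal hhigh

open Classical in
/-- The answer of the Kraft–Chaitin machine on the program `x` to the request `q`, which owns the
interval `[p.1, p.2]`: the request is served if it asks for programs one bit shorter than `x` and
the interval of `x` fits into its own. -/
def serveRequest (x : List Bool) (p : (ℕ × ℕ) × (ℕ × ℕ)) (q : Request) : Option (List Bool) :=
  if x.length = q.1 + 1 ∧ FitsIn x (dyadic p.1) (dyadic p.2) then some q.2 else none

/-- One step of the computation of the Kraft–Chaitin machine: the request with index `i` owns the
interval between the `i`-th and the `(i + 1)`-st partial sum of the weights. -/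
def kraftChaitinStep (r : ℕ → Option Request) (x : List Bool) (i : ℕ) : Option (List Bool) :=
  (r i).bind (serveRequest x (requestSum r i, requestSum r (i + 1)))

/-- The machine which serves the request `(l, σ)` with a program of length `l + 1`: an interval of
length `2 ^ (-l)` with arbitrary dyadic end points contains the interval of a string of this length,
though not always that of a string of length `l`. -/
def kraftChaitinMachine (r : ℕ → Option Request) (x : List Bool) : Part (List Bool) :=
  Nat.rfindOpt (kraftChaitinStep r x)

section KraftChaitin

variable {r : ℕ → Option Request}

theorem mem_kraftChaitinStep_iff {x σ : List Bool} {i : ℕ} :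
    σ ∈ kraftChaitinStep r x i ↔ ∃ l, r i = some (l, σ) ∧ x.length = l + 1 ∧
      FitsIn x (dyadic (requestSum r i)) (dyadic (requestSum r (i + 1))) := by
  simp only [kraftChaitinStep, serveRequest, Option.mem_def, Option.bind_eq_some_iff, Prod.exists,
    Option.ite_none_right_eq_some, Option.some_inj]
  constructor
  · rintro ⟨l, σ, hi, hx, rfl⟩
    exact ⟨l, hi, hx⟩
  · rintro ⟨l, hi, hx⟩
    exact ⟨l, σ, hi, hx, rfl⟩

theorem primrecRel_fitsIn : PrimrecRel fun (x : List Bool) (p : (ℕ × ℕ) × (ℕ × ℕ)) =>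
    FitsIn x (dyadic p.1) (dyadic p.2) := by
  have hval : Primrec fun z : List Bool × (ℕ × ℕ) × (ℕ × ℕ) => binVal z.1 :=
    primrec_binVal.comp Primrec.fst
  have hlen : Primrec fun z : List Bool × (ℕ × ℕ) × (ℕ × ℕ) => z.1.length :=
    Primrec.list_length.comp Primrec.fst
  exact PrimrecPred.and
    (primrecRel_dyadic_le.comp (Primrec.fst.comp Primrec.snd) (Primrec.pair hval hlen))
    (primrecRel_dyadic_le.comp (Primrec.pair (Primrec.succ.comp hval) hlen)
      (Primrec.snd.comp Primrec.snd))

open Classical in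
theorem primrec_serveRequest :
    Primrec₂ fun (z : List Bool × (ℕ × ℕ) × (ℕ × ℕ)) q => serveRequest z.1 z.2 q :=
  Primrec.ite
    (PrimrecPred.and
      (Primrec.eq.comp (Primrec.list_length.comp (Primrec.fst.comp Primrec.fst))
        (Primrec.succ.comp (Primrec.fst.comp Primrec.snd)))
      (primrecRel_fitsIn.comp (Primrec.fst.comp Primrec.fst) (Primrec.snd.comp Primrec.fst)))
    (Primrec.option_some.comp (Primrec.snd.comp Primrec.snd)) (Primrec.const none)

theorem computable_kraftChaitinStep (hr : Computable r) : Computable₂ (kraftChaitinStep r) := by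
  have hsum : Computable (requestSum r) :=
    (computable_dyadicSum (primrec_requestWeight.to_comp.comp (hr.comp Computable.snd)).to₂).comp
      (Computable.const ()) Computable.id
  have hindex : Computable fun z : (List Bool × ℕ) × Request => z.1.2 :=
    Computable.snd.comp Computable.fst
  have hinterval : Computable fun z : (List Bool × ℕ) × Request =>
      (z.1.1, requestSum r z.1.2, requestSum r (z.1.2 + 1)) :=
    Computable.pair (Computable.fst.comp Computable.fst)
      (Computable.pair (hsum.comp hindex) (hsum.comp (Computable.succ.comp hindex)))
  have hserve : Computable₂ fun (z : List Bool × ℕ) (q : Request) =>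
      serveRequest z.1 (requestSum r z.2, requestSum r (z.2 + 1)) q :=
    (primrec_serveRequest.to_comp.comp hinterval Computable.snd).to₂
  exact (hr.comp Computable.snd).option_bind hserve

theorem isPrefixFreeMachine_kraftChaitinMachine (hr : Computable r) :
    IsPrefixFreeMachine (kraftChaitinMachine r) := by
  refine ⟨Partrec.rfindOpt (computable_kraftChaitinStep hr), ?_⟩
  rintro x _ hx hy ⟨y, rfl⟩
  obtain ⟨i, σ, hi⟩ := Nat.rfindOpt_dom.1 hx
  obtain ⟨j, τ, hj⟩ := Nat.rfindOpt_dom.1 hy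
  obtain ⟨l, hri, hxl, hfit⟩ := mem_kraftChaitinStep_iff.1 hi
  obtain ⟨l', hrj, hxyl, hfit'⟩ := mem_kraftChaitinStep_iff.1 hj
  obtain rfl := FitsIn.index_unique (monotone_dyadic_requestSum r) hfit.append hfit'
  obtain ⟨rfl, rfl⟩ : l = l' ∧ σ = τ := by simpa [hri] using hrj
  rw [List.length_append] at hxyl
  rw [List.eq_nil_of_length_eq_zero (l := y) (by omega), List.append_nil]

theorem IsBoundedRequestSequence.exists_mem_kraftChaitinMachine (hr : IsBoundedRequestSequence r)
    {i l : ℕ} {σ : List Bool} (hi : r i = some (l, σ)) :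
    ∃ x : List Bool, σ ∈ kraftChaitinMachine r x ∧ x.length = l + 1 := by
  have hsucc : dyadic (requestSum r (i + 1)) = dyadic (requestSum r i) + 2⁻¹ ^ l := by
    rw [dyadic_requestSum_succ, hi, dyadic_requestWeight_some]
  obtain ⟨x, hx, hfit⟩ := exists_fitsIn
    (hsucc.symm.trans_le ((dyadic_dyadicSum_le_tsum _ (i + 1)).trans hr.tsum_le_one))
  rw [← hsucc] at hfit
  have hdom : (kraftChaitinMachine r x).Dom :=
    Nat.rfindOpt_dom.2 ⟨i, σ, mem_kraftChaitinStep_iff.2 ⟨l, hi, hx, hfit⟩⟩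
  obtain ⟨j, hj⟩ := Nat.rfindOpt_spec (Part.get_mem hdom)
  obtain ⟨l', hrj, -, hfit'⟩ := mem_kraftChaitinStep_iff.1 hj
  obtain rfl := FitsIn.index_unique (monotone_dyadic_requestSum r) hfit hfit'
  obtain ⟨rfl, hσ⟩ : l = l' ∧ σ = (kraftChaitinMachine r x).get hdom := by simpa [hi] using hrj
  exact ⟨x, hσ ▸ Part.get_mem hdom, hx⟩

end KraftChaitin

section Complexity

variable {U : List Bool →. List Bool} {σ τ : List Bool}

theorem K_le_length (h : σ ∈ U τ) : K U σ ≤ τ.length :=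
  Nat.sInf_le ⟨τ, rfl, h⟩

theorem IsUniversalMachine.exists_program_length_le (hU : IsUniversalMachine U)
    {r : ℕ → Option Request} (hr : IsBoundedRequestSequence r) :
    ∃ c : ℕ, ∀ i l σ, r i = some (l, σ) → ∃ τ, σ ∈ U τ ∧ τ.length ≤ l + c := by
  obtain ⟨c, hc⟩ := hU.2 _ (isPrefixFreeMachine_kraftChaitinMachine hr.computable)
  refine ⟨c + 1, fun i l σ hi => ?_⟩
  obtain ⟨x, hx, hxl⟩ := hr.exists_mem_kraftChaitinMachine hi
  obtain ⟨τ, hτ, hτl⟩ := hc x σ hx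
  exact ⟨τ, hτ, by omega⟩

theorem tsum_two_inv_pow_succ : ∑' i : ℕ, (2 : ℝ≥0∞)⁻¹ ^ (i + 1) = 1 := by
  simp_rw [pow_succ]
  rw [ENNReal.tsum_mul_right, ENNReal.tsum_geometric, ENNReal.one_sub_inv_two, inv_inv]
  exact ENNReal.mul_inv_cancel (by simp) (by simp)

theorem IsUniversalMachine.exists_shortest_program (hU : IsUniversalMachine U) (σ : List Bool) :
    ∃ τ, σ ∈ U τ ∧ τ.length = K U σ := by
  have hr : IsBoundedRequestSequence fun i => some (i + 1, σ) :=
    ⟨Computable.option_some.comp (Computable.pair Computable.succ (Computable.const σ)), by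
      simp only [dyadic_requestWeight_some, tsum_two_inv_pow_succ, le_refl]⟩
  obtain ⟨c, hc⟩ := hU.exists_program_length_le hr
  obtain ⟨τ, hτ, -⟩ := hc 0 _ _ rfl
  obtain ⟨τ', hlen, hτ'⟩ :=
    Nat.sInf_mem (s := {n | ∃ τ : List Bool, τ.length = n ∧ σ ∈ U τ}) ⟨_, τ, rfl, hτ⟩
  exact ⟨τ', hτ', hlen⟩

end Complexity

/-! ### Listing the programs of a machine -/

section DescriptionSequences

variable {U : List Bool →. List Bool} {e : ℕ → Option Request}

theorem tsum_two_inv_pow_length_le_one (hU : IsPrefixFreeMachine U) :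
    ∑' p : {p : List Bool // (U p).Dom}, (2 : ℝ≥0∞)⁻¹ ^ p.1.length ≤ 1 := by
  rw [ENNReal.tsum_eq_iSup_sum]
  refine iSup_le fun s => ?_
  have hkraft := kraft_inequality_of_prefixFree (s := s.map (Function.Embedding.subtype _)) (by
    simp only [Finset.mem_map, Function.Embedding.subtype_apply]
    rintro _ ⟨σ, -, rfl⟩ _ ⟨τ, -, rfl⟩ hp
    exact hU.2 _ _ σ.2 τ.2 hp)
  rw [Finset.sum_map, ← ENNReal.ofReal_le_one,
    ENNReal.ofReal_sum_of_nonneg fun _ _ => by positivity] at hkraft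
  refine le_of_eq_of_le (Finset.sum_congr rfl fun p _ => ?_) hkraft
  rw [ENNReal.ofReal_pow (by positivity), ENNReal.ofReal_inv_of_pos (by norm_num),
    ENNReal.ofReal_ofNat, Function.Embedding.subtype_apply]

theorem ofReal_omegaReal (hU : IsPrefixFreeMachine U) :
    ENNReal.ofReal (omegaReal U) =
      ∑' p : {p : List Bool // (U p).Dom}, (2 : ℝ≥0∞)⁻¹ ^ p.1.length := by
  have hne := ne_top_of_le_ne_top ENNReal.one_ne_top (tsum_two_inv_pow_length_le_one hU)
  rw [← ENNReal.ofReal_toReal hne,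
    ENNReal.tsum_toReal_eq fun p => ENNReal.ne_top_of_tsum_ne_top hne p]
  simp [omegaReal]

/-- A primitive recursive listing, without repetitions, of the programs in the domain of `U`.
Only the length and the output of a program are recorded, so that the listing has the form of a
sequence of requests; that there are no repetitions is expressed by the total weight. -/
structure IsDescriptionSequence (U : List Bool →. List Bool) (e : ℕ → Option Request) : Prop where
  primrec : Primrec e
  exists_index : ∀ p x, x ∈ U p → ∃ i, e i = some (p.length, x)
  tsum_eq : ∑' i, dyadic (requestWeight (e i)) = ENNReal.ofReal (omegaReal U)

theorem IsDescriptionSequence.tsum_le_one (he : IsDescriptionSequence U e)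
    (hU : IsPrefixFreeMachine U) : ∑' i, dyadic (requestWeight (e i)) ≤ 1 := by
  rw [he.tsum_eq, ofReal_omegaReal hU]
  exact tsum_two_inv_pow_length_le_one hU

theorem IsPrefixFreeMachine.exists_isDescriptionSequence (hU : IsPrefixFreeMachine U) :
    ∃ e, IsDescriptionSequence U e := by
  obtain ⟨e, hprim, he, hinj⟩ := exists_primrec_injective_enumeration hU.1
  refine ⟨fun i => (e i).map fun x => (x.1.length, x.2), ?_, fun p x hx => ?_, ?_⟩
  · exact Primrec.option_map hprim (Primrec.pair
      (Primrec.list_length.comp (Primrec.fst.comp Primrec.snd)) (Primrec.snd.comp Primrec.snd)).to₂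
  · obtain ⟨i, hi⟩ := (he p x).1 hx
    exact ⟨i, by rw [hi, Option.map_some]⟩
  have hindex (p : {p : List Bool // (U p).Dom}) : ∃ i, e i = some (p.1, (U p.1).get p.2) :=
    (he _ _).1 (Part.get_mem p.2)
  choose index hindex using hindex
  have hindex_inj : Function.Injective index := fun p q hpq => by
    have hp := hindex p
    rw [hpq, hindex q, Option.some_inj, Prod.mk.injEq] at hp
    exact Subtype.ext hp.1.symm
  rw [ofReal_omegaReal hU, ← hindex_inj.tsum_eq]
  · exact tsum_congr fun p => by rw [hindex p, Option.map_some, dyadic_requestWeight_some]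
  · intro i hi
    rcases h : e i with _ | ⟨p, x⟩
    · simp [h, dyadic_requestWeight_none] at hi
    · obtain ⟨hdom, rfl⟩ := (he p x).2 ⟨i, h⟩
      exact ⟨⟨p, hdom⟩, hinj _ _ _ (hindex ⟨p, hdom⟩) h⟩

end DescriptionSequences

/-! ### The a priori semi-measure of a sequence of requests -/

open Classical in
/-- The request `o` if it asks for a string in `S`, and no request otherwise. -/
def select (S : Set (List Bool)) (o : Option Request) : Option Request :=
  o.filter fun q => q.2 ∈ S

/-- The total weight of the requests for the string `σ`. For a listing of the programs of a machine,
this is the probability that the machine outputs `σ`. -/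
def outputWeight (e : ℕ → Option Request) (σ : List Bool) : ℝ≥0∞ :=
  ∑' i, dyadic (requestWeight (select {σ} (e i)))

section OutputWeight

variable {e : ℕ → Option Request} {S S' : Set (List Bool)}

open Classical in
theorem primrec_select {α : Type*} [Primcodable α] {P : α → List Bool → Prop}
    (hP : PrimrecRel P) : Primrec₂ fun a o => select {σ | P a σ} o := by
  have hbody : Primrec₂ fun (z : α × Option Request) (q : Request) =>
      if P z.1 q.2 then some q else none :=
    Primrec.ite (hP.comp (Primrec.fst.comp Primrec.fst) (Primrec.snd.comp Primrec.snd))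
      (Primrec.option_some.comp Primrec.snd) (Primrec.const none)
  refine (Primrec.option_bind Primrec.snd hbody).of_eq fun z => ?_
  cases z.2 <;> simp [select, Option.filter]

theorem select_none : select S none = none := rfl

theorem select_some_of_mem {q : Request} (h : q.2 ∈ S) : select S (some q) = some q := by
  simp [select, h]

theorem select_some_of_notMem {q : Request} (h : q.2 ∉ S) : select S (some q) = none := by
  simp [select, h]

theorem dyadic_requestWeight_select_mono (h : S ⊆ S') (o : Option Request) :
    dyadic (requestWeight (select S o)) ≤ dyadic (requestWeight (select S' o)) := by
  rcases o with _ | q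
  · rfl
  · by_cases hq : q.2 ∈ S
    · rw [select_some_of_mem hq, select_some_of_mem (h hq)]
    · rw [select_some_of_notMem hq, dyadic_requestWeight_none]
      exact zero_le

theorem dyadic_requestWeight_select_le (S : Set (List Bool)) (o : Option Request) :
    dyadic (requestWeight (select S o)) ≤ dyadic (requestWeight o) := by
  refine (dyadic_requestWeight_select_mono (Set.subset_univ S) o).trans_eq ?_
  rcases o with _ | q
  · rfl
  · rw [select_some_of_mem (Set.mem_univ _)]

theorem tsum_dyadic_requestWeight_select_singleton (S : Set (List Bool)) (o : Option Request) :
    ∑' σ : S, dyadic (requestWeight (select {σ.1} o)) = dyadic (requestWeight (select S o)) := by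
  rcases o with _ | q
  · simp only [select_none, dyadic_requestWeight_none, tsum_zero]
  have hne (σ : S) (h : q.2 ≠ σ) : dyadic (requestWeight (select {σ.1} (some q))) = 0 := by
    rw [select_some_of_notMem (by simpa using h), dyadic_requestWeight_none]
  by_cases hq : q.2 ∈ S
  · rw [tsum_eq_single ⟨q.2, hq⟩ fun σ hσ => hne σ fun h => hσ (Subtype.ext h.symm),
      select_some_of_mem hq, select_some_of_mem (Set.mem_singleton q.2)]
  · rw [select_some_of_notMem hq, dyadic_requestWeight_none]
    exact ENNReal.tsum_eq_zero.2 fun σ => hne σ fun h => hq (h ▸ σ.2)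

theorem weight_outputWeight (e : ℕ → Option Request) (S : Set (List Bool)) :
    weight (outputWeight e) S = ∑' i, dyadic (requestWeight (select S (e i))) := by
  simp only [weight, outputWeight]
  rw [ENNReal.tsum_comm]
  exact tsum_congr fun i => tsum_dyadic_requestWeight_select_singleton S (e i)

theorem isSemimeasureIn_outputWeight (he : Primrec e)
    (hsum : ∑' i, dyadic (requestWeight (e i)) ≤ 1) : IsSemimeasureIn ∅ (outputWeight e) := by
  constructor
  · rw [← tsum_univ, ← weight, weight_outputWeight]
    exact (ENNReal.tsum_le_tsum fun i => dyadic_requestWeight_select_le _ _).trans hsum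
  · refine ⟨fun σ => dyadicSum fun i => requestWeight (select {σ} (e i)), ?_, fun σ =>
      ⟨monotone_dyadic_dyadicSum _, tendsto_dyadic_dyadicSum _⟩⟩
    have hselect : Primrec₂ fun σ i => requestWeight (select {σ} (e i)) :=
      primrec_requestWeight.comp ((primrec_select (P := fun σ τ : List Bool => τ = σ)
        (Primrec.eq.comp Primrec.snd Primrec.fst)).comp Primrec.fst (he.comp Primrec.snd))
    exact computableIn_empty_iff.2 (primrec_dyadicSum hselect).to_comp

theorem IsUniversalSemimeasureIn.exists_tsum_select_le {m : List Bool → ℝ≥0∞}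
    (hm : IsUniversalSemimeasureIn ∅ m) (he : Primrec e)
    (hsum : ∑' i, dyadic (requestWeight (e i)) ≤ 1) :
    ∃ b : ℕ, ∀ S, ∑' i, dyadic (requestWeight (select S (e i))) ≤ 2 ^ b * weight m S := by
  obtain ⟨c, hc⟩ := hm.2 _ (isSemimeasureIn_outputWeight he hsum)
  obtain ⟨b, hb⟩ := pow_unbounded_of_one_lt c (one_lt_two : (1 : ℝ≥0) < 2)
  refine ⟨b, fun S => ?_⟩
  rw [← weight_outputWeight, weight, weight, ← ENNReal.tsum_mul_left]
  refine ENNReal.tsum_le_tsum fun σ => (hc σ).trans ?_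
  gcongr
  exact_mod_cast hb.le

end OutputWeight

/-! ### The canonical tree of an effectively closed class -/

section Prefixes

variable {σ τ : List Bool} {X : ℕ → Bool}

theorem isInitial_restrict (X : ℕ → Bool) (n : ℕ) : IsInitial (restrict X n) X := by
  rw [IsInitial, length_restrict]

theorem take_restrict (X : ℕ → Bool) {k n : ℕ} (h : k ≤ n) :
    (restrict X n).take k = restrict X k := by
  rw [restrict, ← List.map_take, List.take_range, min_eq_left h, restrict]

theorem IsInitial.take_eq_restrict (h : IsInitial σ X) {k : ℕ} (hk : k ≤ σ.length) :
    σ.take k = restrict X k := by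
  rw [← take_restrict X hk, h]

theorem IsInitial.of_append (h : IsInitial (σ ++ τ) X) : IsInitial σ X := by
  rw [IsInitial, ← h.take_eq_restrict (by simp), List.take_left]

theorem isInitial_iff_getElem : IsInitial σ X ↔ ∀ i : Fin σ.length, X i = σ[i] := by
  simp only [IsInitial, restrict, List.ext_getElem_iff, List.length_map, List.length_range,
    List.getElem_map, List.getElem_range, true_and]
  exact ⟨fun h i => h i i.2 i.2, fun h i hi _ => h ⟨i, hi⟩⟩

theorem exists_isInitial (σ : List Bool) : ∃ X, IsInitial σ X :=
  ⟨fun i => σ.getD i false, isInitial_iff_getElem.2 fun i => by simp⟩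

theorem isClopen_setOf_isInitial (σ : List Bool) : IsClopen {X | IsInitial σ X} := by
  simp only [isInitial_iff_getElem, Set.ofPred_forall]
  exact isClopen_iInter_of_finite fun i =>
    (isClopen_discrete {σ[i]}).preimage (continuous_apply (i : ℕ))

end Prefixes

/-- The list of all strings of length `n`, the range of the quantifier in `IsCoveredAt`. -/
def strings (n : ℕ) : List (List Bool) :=
  Nat.rec [[]] (fun _ L => L.map (List.cons true) ++ L.map (List.cons false)) n

/-- The cylinder of `τ` is seen to be covered at stage `u`, where `R σ u` says that the cylinder of
`σ` has been enumerated by stage `u`: every extension of `τ` by `u` bits has a prefix of length at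
most `u` whose cylinder has been enumerated. -/
def IsCoveredAt (R : List Bool → ℕ → Prop) (τ : List Bool) (u : ℕ) : Prop :=
  ∀ ρ ∈ strings u, ∃ k ∈ List.range (u + 1), R ((τ ++ ρ).take k) u

theorem mem_strings {n : ℕ} {ρ : List Bool} : ρ ∈ strings n ↔ ρ.length = n := by
  induction n generalizing ρ with
  | zero => simp [strings]
  | succ n ih =>
    change ρ ∈ (strings n).map _ ++ (strings n).map _ ↔ _
    cases ρ with
    | nil => simp
    | cons b ρ => cases b <;> simp [ih]

theorem primrec_strings : Primrec strings := by
  have hcons (b : Bool) : Primrec fun z : ℕ × List (List Bool) => z.2.map (List.cons b) :=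
    Primrec.list_map Primrec.snd (Primrec.list_cons.comp (Primrec.const b) Primrec.snd).to₂
  exact Primrec.nat_rec₁ _ (Primrec.list_append.comp (hcons true) (hcons false)).to₂

section CanonicalTree

variable {C : Set (ℕ → Bool)} {R : List Bool → ℕ → Prop} {τ : List Bool}

theorem primrecRel_isCoveredAt (hR : PrimrecRel R) : PrimrecRel (IsCoveredAt R) := by
  have htake : PrimrecRel fun (k : ℕ) (z : List Bool × List Bool × ℕ) =>
      R ((z.2.1 ++ z.1).take k) z.2.2 :=
    hR.comp
      (Primrec.list_take.comp Primrec.fst (Primrec.list_append.comp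
        (Primrec.fst.comp (Primrec.snd.comp Primrec.snd)) (Primrec.fst.comp Primrec.snd)))
      (Primrec.snd.comp (Primrec.snd.comp Primrec.snd))
  have hexists : PrimrecRel fun (ρ : List Bool) (z : List Bool × ℕ) =>
      ∃ k ∈ List.range (z.2 + 1), R ((z.1 ++ ρ).take k) z.2 :=
    htake.exists_mem_list.comp
      (Primrec.list_range.comp (Primrec.succ.comp (Primrec.snd.comp Primrec.snd))) Primrec.id
  exact hexists.forall_mem_list.comp (primrec_strings.comp Primrec.snd) Primrec.id

theorem not_isCoveredAt (hC : Cᶜ = {X | ∃ σ, (∃ u, R σ u) ∧ IsInitial σ X})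
    (hτ : τ ∈ canonicalTree C) (u : ℕ) : ¬IsCoveredAt R τ u := by
  obtain ⟨X, hX, hτX⟩ := hτ
  intro hcov
  have hext : τ ++ (restrict X (τ.length + u)).drop τ.length = restrict X (τ.length + u) := by
    conv_lhs => enter [1]; rw [← hτX, ← take_restrict X (Nat.le_add_right τ.length u)]
    exact List.take_append_drop _ _
  obtain ⟨k, hk, hRk⟩ := hcov ((restrict X (τ.length + u)).drop τ.length)
    (mem_strings.2 (by simp [length_restrict]))
  rw [hext, take_restrict X (by rw [List.mem_range] at hk; omega)] at hRk
  have hXC : X ∈ Cᶜ := hC ▸ ⟨restrict X k, ⟨u, hRk⟩, isInitial_restrict X k⟩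
  exact hXC hX

theorem exists_isCoveredAt (hR : ∀ σ, Monotone (R σ))
    (hC : Cᶜ = {X | ∃ σ, (∃ u, R σ u) ∧ IsInitial σ X}) (hτ : τ ∉ canonicalTree C) :
    ∃ u, IsCoveredAt R τ u := by
  let V (u : ℕ) : Set (ℕ → Bool) := {X | ∃ σ, (σ.length ≤ u ∧ R σ u) ∧ IsInitial σ X}
  have hmono : Monotone V := by
    rintro u v huv X ⟨σ, ⟨hlen, hσ⟩, hX⟩
    exact ⟨σ, ⟨hlen.trans huv, hR σ huv hσ⟩, hX⟩
  have hopen (u : ℕ) : IsOpen (V u) := by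
    simp only [V, Set.ofPred_exists]
    exact isOpen_iUnion fun σ => isOpen_const.inter (isClopen_setOf_isInitial σ).isOpen
  have hcover : {X | IsInitial τ X} ⊆ ⋃ u, V u := by
    intro X hX
    have hXC : X ∈ Cᶜ := fun hXC => hτ ⟨X, hXC, hX⟩
    rw [hC] at hXC
    obtain ⟨σ, ⟨u, hσ⟩, hσX⟩ := hXC
    exact Set.mem_iUnion.2 ⟨max σ.length u, σ, ⟨le_max_left _ _, hR σ (le_max_right _ _) hσ⟩, hσX⟩
  obtain ⟨u, hu⟩ := (isClopen_setOf_isInitial τ).isClosed.isCompact.elim_directed_cover V hopen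
    hcover hmono.directed_le
  refine ⟨u, fun ρ hρ => ?_⟩
  obtain ⟨X, hX⟩ := exists_isInitial (τ ++ ρ)
  obtain ⟨σ, ⟨hlen, hσ⟩, hσX⟩ := hu hX.of_append
  refine ⟨σ.length, List.mem_range.2 (by omega), ?_⟩
  rwa [hX.take_eq_restrict (by rw [List.length_append, mem_strings.1 hρ]; omega), hσX]

theorem IsPi01.rePred_notMem_canonicalTree (hC : IsPi01 C) :
    REPred fun τ => τ ∉ canonicalTree C := by
  obtain ⟨S, hS, hCS⟩ := hC
  obtain ⟨R, hR, hmono, hSR⟩ := exists_primrecRel_stages hS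
  simp only [hSR] at hCS
  refine (rePred_exists (primrecRel_isCoveredAt hR).computablePred).of_eq fun τ => ?_
  exact ⟨fun ⟨u, hu⟩ hτ => not_isCoveredAt hCS hτ u hu, exists_isCoveredAt hmono hCS⟩

open Classical in
theorem IsPi01.rePred_notMem_level (hC : IsPi01 C) {f : ℕ → ℕ} (hf : Computable f) :
    REPred fun p : ℕ × List Bool => p.2 ∉ level (canonicalTree C) (f p.1) := by
  obtain ⟨R, hR, -, hCR⟩ := exists_primrecRel_stages hC.rePred_notMem_canonicalTree
  have hstage : PrimrecPred fun z : (List Bool × ℕ) × ℕ => R z.1.1 z.1.2 ∨ ¬z.1.1.length = z.2 :=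
    (hR.comp (Primrec.fst.comp Primrec.fst) (Primrec.snd.comp Primrec.fst)).or
      (Primrec.eq.comp (Primrec.list_length.comp (Primrec.fst.comp Primrec.fst)) Primrec.snd).not
  have hdata : Computable fun x : (ℕ × List Bool) × ℕ => ((x.1.2, x.2), f x.1.1) :=
    Computable.pair (Computable.pair (Computable.snd.comp Computable.fst) Computable.snd)
      (hf.comp (Computable.fst.comp Computable.fst))
  refine (rePred_exists (R := fun p u => R p.2 u ∨ ¬p.2.length = f p.1)
    ⟨inferInstance, hstage.decide.to_comp.comp hdata⟩).of_eq fun p => ?_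
  rw [level, Set.mem_ofPred_eq, not_and_or, hCR, exists_or, exists_const]

end CanonicalTree

/-! ### Joint descriptions -/

open Classical in
/-- The pair of the `i`-th and the `j`-th request, provided that `u` is the first stage at which the
`j`-th request is found to be eligible for the string of the `i`-th one. -/
def eligiblePair (e : ℕ → Option Request) (R : List Bool × ℕ → ℕ → Prop) (i j u : ℕ) :
    Option (Request × Request) :=
  (e i).bind fun q => (e j).bind fun q' =>
    if IsLeast {v | R (q.2, j) v} u then some (q, q') else none

/-- The request for a description of `⟨σ, τ⟩` that saves `g σ - b` bits over the descriptions of `σ`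
and `τ` asked for by the requests `x.1` and `x.2`. -/
def jointRequest (pair : List Bool × List Bool → List Bool) (g : List Bool → ℕ) (b : ℕ)
    (x : Request × Request) : Request :=
  (x.1.1 + (x.2.1 + b - g x.1.2), pair (x.1.2, x.2.2))

section JointDescriptions

variable {e : ℕ → Option Request} {R : List Bool × ℕ → ℕ → Prop}
  {pair : List Bool × List Bool → List Bool} {g : List Bool → ℕ} {b : ℕ} {D : List Bool → Set ℕ}

open Classical in
theorem primrec_eligiblePair (he : Primrec e) (hR : PrimrecRel R) :
    Primrec fun x : ℕ × ℕ × ℕ => eligiblePair e R x.1 x.2.1 x.2.2 := by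
  have hbody : Primrec₂ fun (z : (ℕ × ℕ × ℕ) × Request) (q : Request) =>
      if IsLeast {v | R (z.2.2, z.1.2.1) v} z.1.2.2 then some (z.2, q) else none :=
    Primrec.ite
      ((primrecRel_isLeast hR).comp
        (Primrec.pair (Primrec.snd.comp (Primrec.snd.comp Primrec.fst))
          (Primrec.fst.comp (Primrec.snd.comp (Primrec.fst.comp Primrec.fst))))
        (Primrec.snd.comp (Primrec.snd.comp (Primrec.fst.comp Primrec.fst))))
      (Primrec.option_some.comp (Primrec.pair (Primrec.snd.comp Primrec.fst) Primrec.snd))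
      (Primrec.const none)
  exact Primrec.option_bind (he.comp Primrec.fst) (Primrec.option_bind
    (he.comp (Primrec.fst.comp (Primrec.snd.comp Primrec.fst))) hbody).to₂

theorem computable_jointRequest (hpair : Computable pair) (hg : Computable g) (b : ℕ) :
    Computable (jointRequest pair g b) := by
  have hsub : Computable fun x : Request × Request => x.2.1 + b - g x.1.2 :=
    Primrec.nat_sub.to_comp.comp
      (Primrec.nat_add.comp (Primrec.fst.comp Primrec.snd) (Primrec.const b)).to_comp
      (hg.comp (Computable.snd.comp Computable.fst))
  exact Computable.pair
    (Primrec.nat_add.to_comp.comp (Computable.fst.comp Computable.fst) hsub)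
    (hpair.comp (Computable.pair (Computable.snd.comp Computable.fst)
      (Computable.snd.comp Computable.snd)))

theorem two_pow_mul_two_inv_pow (n : ℕ) : (2 : ℝ≥0∞) ^ n * 2⁻¹ ^ n = 1 := by
  rw [← mul_pow, ENNReal.mul_inv_cancel (by simp) (by simp), one_pow]

theorem two_inv_pow_add_sub {p q n d : ℕ} (h : n ≤ q + d) :
    (2 : ℝ≥0∞)⁻¹ ^ (p + (q + d - n)) = 2⁻¹ ^ p * (2 ^ n * 2⁻¹ ^ d) * 2⁻¹ ^ q := by
  obtain ⟨r, hr⟩ := Nat.exists_eq_add_of_le h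
  calc (2 : ℝ≥0∞)⁻¹ ^ (p + (q + d - n)) = 2⁻¹ ^ p * (2 ^ n * 2⁻¹ ^ n * 2⁻¹ ^ r) := by
        rw [two_pow_mul_two_inv_pow, one_mul, hr, Nat.add_sub_cancel_left, pow_add]
    _ = 2⁻¹ ^ p * (2 ^ n * 2⁻¹ ^ (q + d)) := by rw [hr, pow_add, mul_assoc]
    _ = 2⁻¹ ^ p * (2 ^ n * 2⁻¹ ^ d) * 2⁻¹ ^ q := by rw [pow_add]; ring

theorem le_add_of_two_inv_pow_le {n l b : ℕ} (h : (2 : ℝ≥0∞)⁻¹ ^ l ≤ 2 ^ b * 2⁻¹ ^ n) :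
    n ≤ l + b := by
  have hdyadic : dyadic (1, l) ≤ dyadic (2 ^ b, n) := by
    rwa [dyadic_one, dyadic_mk, Nat.cast_pow, Nat.cast_ofNat]
  rw [dyadic_le_dyadic_iff, one_mul, ← pow_add, add_comm] at hdyadic
  exact (Nat.pow_le_pow_iff_right one_lt_two).1 hdyadic

theorem tsum_requestWeight_eligiblePair (hR : ∀ σ j, j ∈ D σ ↔ ∃ u, R (σ, j) u) {i : ℕ}
    {q : Request} (hi : e i = some q) (j : ℕ) :
    ∑' u, dyadic (requestWeight ((eligiblePair e R i j u).map (jointRequest pair g b))) =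
      (D q.2).indicator (fun j =>
        dyadic (requestWeight ((e j).map fun q' => jointRequest pair g b (q, q')))) j := by
  have hnone {u : ℕ} (hu : ¬IsLeast {v | R (q.2, j) v} u) :
      dyadic (requestWeight ((eligiblePair e R i j u).map (jointRequest pair g b))) = 0 := by
    simp [eligiblePair, hi, hu, dyadic_requestWeight_none]
  by_cases hj : j ∈ D q.2
  · classical
    have hleast := Nat.isLeast_find ((hR _ _).1 hj)
    rw [tsum_eq_single _ fun v hv => hnone fun hv' => hv (hv'.unique hleast),
      Set.indicator_of_mem hj]
    cases he : e j <;> simp [eligiblePair, hi, he, hleast]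
  · rw [Set.indicator_of_notMem hj]
    exact ENNReal.tsum_eq_zero.2 fun u => hnone fun hu => hj ((hR _ _).2 ⟨u, hu.1⟩)

theorem requestWeight_jointRequest
    (hD : ∀ σ, ∑' j : D σ, dyadic (requestWeight (e j)) ≤ 2 ^ b * 2⁻¹ ^ g σ) (q : Request)
    (j : D q.2) :
    dyadic (requestWeight ((e j).map fun q' => jointRequest pair g b (q, q'))) =
      2⁻¹ ^ q.1 * (2 ^ g q.2 * 2⁻¹ ^ b) * dyadic (requestWeight (e j)) := by
  have hj := (ENNReal.le_tsum j).trans (hD q.2)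
  cases he : e j with
  | none => simp [dyadic_requestWeight_none]
  | some q' =>
    rw [he, dyadic_requestWeight_some] at hj
    rw [Option.map_some, dyadic_requestWeight_some, dyadic_requestWeight_some]
    exact two_inv_pow_add_sub (le_add_of_two_inv_pow_le hj)

theorem tsum_jointRequest_le (hR : ∀ σ j, j ∈ D σ ↔ ∃ u, R (σ, j) u)
    (hD : ∀ σ, ∑' j : D σ, dyadic (requestWeight (e j)) ≤ 2 ^ b * 2⁻¹ ^ g σ) (i : ℕ) :
    ∑' j, ∑' u, dyadic (requestWeight ((eligiblePair e R i j u).map (jointRequest pair g b))) ≤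
      dyadic (requestWeight (e i)) := by
  rcases hi : e i with _ | q
  · simp [eligiblePair, hi, dyadic_requestWeight_none]
  simp only [tsum_requestWeight_eligiblePair hR hi]
  rw [← tsum_subtype, dyadic_requestWeight_some]
  calc ∑' j : D q.2, dyadic (requestWeight ((e j).map fun q' => jointRequest pair g b (q, q')))
      = 2⁻¹ ^ q.1 * (2 ^ g q.2 * 2⁻¹ ^ b) * ∑' j : D q.2, dyadic (requestWeight (e j)) := by
        rw [← ENNReal.tsum_mul_left]
        exact tsum_congr (requestWeight_jointRequest hD q)
    _ ≤ 2⁻¹ ^ q.1 * (2 ^ g q.2 * 2⁻¹ ^ b) * (2 ^ b * 2⁻¹ ^ g q.2) := by gcongr; exact hD q.2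
    _ = 2⁻¹ ^ q.1 * (2 ^ g q.2 * 2⁻¹ ^ g q.2) * (2 ^ b * 2⁻¹ ^ b) := by ring
    _ = 2⁻¹ ^ q.1 := by rw [two_pow_mul_two_inv_pow, two_pow_mul_two_inv_pow, mul_one, mul_one]

theorem tsum_unpair (F : ℕ → ℕ → ℝ≥0∞) :
    ∑' k : ℕ, F k.unpair.1 k.unpair.2 = ∑' i, ∑' j, F i j := by
  rw [← ENNReal.tsum_prod, ← Nat.pairEquiv.symm.tsum_eq]
  rfl

theorem isBoundedRequestSequence_jointRequest (he : Primrec e)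
    (hsum : ∑' i, dyadic (requestWeight (e i)) ≤ 1) (hRprim : PrimrecRel R)
    (hpair : Computable pair) (hg : Computable g) (hR : ∀ σ j, j ∈ D σ ↔ ∃ u, R (σ, j) u)
    (hD : ∀ σ, ∑' j : D σ, dyadic (requestWeight (e j)) ≤ 2 ^ b * 2⁻¹ ^ g σ) :
    IsBoundedRequestSequence fun k => (eligiblePair e R k.unpair.1 k.unpair.2.unpair.1
      k.unpair.2.unpair.2).map (jointRequest pair g b) where
  computable := by
    have hunpair : Primrec fun k : ℕ => (k.unpair.1, k.unpair.2.unpair) :=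
      Primrec.pair (Primrec.fst.comp Primrec.unpair)
        (Primrec.unpair.comp (Primrec.snd.comp Primrec.unpair))
    exact Computable.option_map ((primrec_eligiblePair he hRprim).comp hunpair).to_comp
      ((computable_jointRequest hpair hg b).comp Computable.snd).to₂
  tsum_le_one := by
    let F (i j u : ℕ) : ℝ≥0∞ :=
      dyadic (requestWeight ((eligiblePair e R i j u).map (jointRequest pair g b)))
    calc ∑' k : ℕ, F k.unpair.1 k.unpair.2.unpair.1 k.unpair.2.unpair.2
        = ∑' i, ∑' j, ∑' u, F i j u := by
          rw [← tsum_congr fun i => tsum_unpair (F i), ← tsum_unpair]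
      _ ≤ ∑' i, dyadic (requestWeight (e i)) := ENNReal.tsum_le_tsum (tsum_jointRequest_le hR hD)
      _ ≤ 1 := hsum

/-- The semi-measures `τ ↦ ∑_{j ∈ D σ, τ_j = τ} 2 ^ (-l_j)`, where `(l_j, τ_j)` is the `j`-th
request listed, are uniformly lower semi-computable and have total weight `O(2 ^ (-g σ))`. Scaling
them up by `2 ^ g σ` shortens the description of `τ` by `g σ` bits, given a description of `σ`. -/
theorem IsUniversalMachine.exists_sub_le_mutualInfo {U : List Bool →. List Bool}
    (hU : IsUniversalMachine U) (he : IsDescriptionSequence U e)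
    {pair : List Bool × List Bool ≃ List Bool} (hpair : Computable pair) (hg : Computable g)
    (hDre : REPred fun x : List Bool × ℕ => x.2 ∈ D x.1)
    (hD : ∀ σ, ∑' j : D σ, dyadic (requestWeight (e j)) ≤ 2 ^ b * 2⁻¹ ^ g σ) :
    ∃ c : ℕ, ∀ σ τ j, j ∈ D σ → e j = some (K U τ, τ) →
      (g σ : ℤ) - c ≤ mutualInfo U pair σ τ := by
  obtain ⟨R, hRprim, -, hR⟩ := exists_primrecRel_stages hDre
  replace hR (σ : List Bool) (j : ℕ) : j ∈ D σ ↔ ∃ u, R (σ, j) u := hR (σ, j)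
  obtain ⟨c, hc⟩ := hU.exists_program_length_le (isBoundedRequestSequence_jointRequest he.primrec
    (he.tsum_le_one hU.1) hRprim hpair hg hR hD)
  refine ⟨b + c, fun σ τ j hj hτ => ?_⟩
  obtain ⟨p, hp, hpK⟩ := hU.exists_shortest_program σ
  obtain ⟨i, hi⟩ := he.exists_index p σ hp
  obtain ⟨u, hu⟩ : ∃ u, IsLeast {v | R (σ, j) v} u := by
    classical exact ⟨_, Nat.isLeast_find ((hR σ j).1 hj)⟩
  obtain ⟨x, hx, hxlen⟩ := hc (Nat.pair i (Nat.pair j u)) (p.length + (K U τ + b - g σ))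
    (pair (σ, τ)) (by simp [eligiblePair, hi, hτ, hu, jointRequest])
  have hg_le : g σ ≤ K U τ + b := by
    have hweight := (ENNReal.le_tsum (⟨j, hj⟩ : D σ)).trans (hD σ)
    rw [hτ, dyadic_requestWeight_some] at hweight
    exact le_add_of_two_inv_pow_le hweight
  have hK := K_le_length hx
  rw [mutualInfo]
  omega

end JointDescriptions

/-! ### Stages at which the halting probability is nearly exhausted -/

theorem tsum_le_sum_range_add {w v : ℕ → ℝ≥0∞} {s : Set ℕ} {u : ℕ} {δ : ℝ≥0∞}
    (hvw : ∀ j, v j ≤ w j) (hw : ∑ i ∈ Finset.range u, w i ≠ ∞)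
    (hs : ∀ j ∈ s, ∑ i ∈ Finset.range (j + 1), w i ≤ ∑ i ∈ Finset.range u, w i + δ) :
    ∑' j : s, v j ≤ ∑ j ∈ Finset.range u, v j + δ := by
  rw [tsum_subtype]
  refine ENNReal.tsum_le_of_sum_range_le fun n => ?_
  induction n with
  | zero => simp
  | succ n ih =>
    by_cases hn : n ∈ s
    · refine (Finset.sum_le_sum fun j _ => Set.indicator_le_self s v j).trans ?_
      rcases le_or_gt (n + 1) u with hnu | hnu
      · exact (Finset.sum_le_sum_of_subset (Finset.range_mono hnu)).trans le_self_add
      · have hsum := hs n hn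
        rw [← Finset.sum_range_add_sum_Ico _ hnu.le] at hsum ⊢
        gcongr
        exact (Finset.sum_le_sum fun j _ => hvw j).trans ((ENNReal.add_le_add_iff_left hw).1 hsum)
    · rwa [Finset.sum_range_succ, Set.indicator_of_notMem hn, add_zero]

theorem tendsto_tsum_of_dominated {F : ℕ → ℕ → ℝ≥0∞} {G w : ℕ → ℝ≥0∞} (hw : ∑' i, w i ≠ ∞)
    (hF : ∀ u i, F u i ≤ w i) (hlim : ∀ i, Filter.Tendsto (F · i) Filter.atTop (𝓝 (G i))) :
    Filter.Tendsto (fun u => ∑' i, F u i) Filter.atTop (𝓝 (∑' i, G i)) := by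
  simp_rw [← MeasureTheory.lintegral_count] at hw ⊢
  exact MeasureTheory.tendsto_lintegral_of_dominated_convergence w (fun _ => measurable_from_top)
    (fun u => Filter.Eventually.of_forall (hF u)) hw (Filter.Eventually.of_forall hlim)

theorem dyadic_floor_omegaReal (U : List Bool →. List Bool) (n : ℕ) :
    dyadic (⌊omegaReal U⌋₊ * 2 ^ n + binVal (restrict (omega U) n), n) ≤
        ENNReal.ofReal (omegaReal U) ∧
      ENNReal.ofReal (omegaReal U) ≤
        dyadic (⌊omegaReal U⌋₊ * 2 ^ n + binVal (restrict (omega U) n), n) + 2⁻¹ ^ n := by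
  have hpos : 0 ≤ omegaReal U := tsum_nonneg fun _ => by positivity
  have hfloor : ⌊omegaReal U⌋₊ * 2 ^ n + binVal (restrict (omega U) n) =
      ⌊omegaReal U * 2 ^ n⌋₊ := (floor_mul_two_pow (omegaReal U) n).symm
  have hadd (k : ℕ) : dyadic (k, n) + 2⁻¹ ^ n = dyadic (k + 1, n) := by
    rw [← dyadic_one, dyadic, dyadic, dyadic, ← ENNReal.add_div, Nat.cast_one, Nat.cast_succ]
  rw [hadd, hfloor, dyadic_eq_ofReal, dyadic_eq_ofReal]
  constructor
  · exact ENNReal.ofReal_le_ofReal ((div_le_iff₀ (by positivity)).2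
      (Nat.floor_le (by positivity)))
  · refine ENNReal.ofReal_le_ofReal ((le_div_iff₀ (by positivity)).2 ?_)
    exact_mod_cast (Nat.lt_floor_add_one (omegaReal U * 2 ^ n)).le

/-- The strings not yet excluded at stage `u` from the `n`-th member of a sequence of co-c.e. sets,
where `E (n, τ) u` says that `τ` has been excluded from it by stage `u`. -/
def survivors (E : ℕ × List Bool → ℕ → Prop) (n u : ℕ) : Set (List Bool) :=
  {τ | ¬E (n, τ) u}

theorem mem_survivors {E : ℕ × List Bool → ℕ → Prop} {n u : ℕ} {τ : List Bool} :
    τ ∈ survivors E n u ↔ ¬E (n, τ) u :=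
  Iff.rfl

/-- The stage `u` is good for a string `σ` of length `n` if, assuming that `σ` is a prefix of the
fractional part of `Ω` and that `N` is its integer part, all but `2 ^ (-n)` of the halting
probability has been listed before stage `u`, while the listed programs for surviving strings have
weight at most `2 ^ (b - n)`. -/
def IsGoodStage (e : ℕ → Option Request) (E : ℕ × List Bool → ℕ → Prop) (N b : ℕ) (σ : List Bool)
    (u : ℕ) : Prop :=
  dyadic (N * 2 ^ σ.length + binVal σ, σ.length) ≤
      dyadic (requestSum e u) + 2⁻¹ ^ σ.length ∧
    dyadic (requestSum (fun i => select (survivors E σ.length u) (e i)) u) ≤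
      2 ^ b * 2⁻¹ ^ σ.length

/-- The programs for strings that survive at the first good stage for `σ`, as long as the halting
probability has grown by no more than `2 ^ (1 - |σ|)` since that stage. -/
def eligible (e : ℕ → Option Request) (E : ℕ × List Bool → ℕ → Prop) (N b : ℕ) (σ : List Bool) :
    Set ℕ :=
  {j | ∃ u, IsLeast {v | IsGoodStage e E N b σ v} u ∧
    select (survivors E σ.length u) (e j) = e j ∧
      dyadic (requestSum e (j + 1)) ≤ dyadic (requestSum e u) + 2 * 2⁻¹ ^ σ.length}

section GoodStages

variable {e : ℕ → Option Request} {E : ℕ × List Bool → ℕ → Prop} {N b : ℕ}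

theorem primrec_select_survivors (hE : PrimrecRel E) :
    Primrec fun x : (ℕ × ℕ) × Option Request => select (survivors E x.1.1 x.1.2) x.2 :=
  primrec_select (P := fun (x : ℕ × ℕ) τ => ¬E (x.1, τ) x.2)
    (hE.not.comp (Primrec.pair (Primrec.fst.comp Primrec.fst) Primrec.snd)
      (Primrec.snd.comp Primrec.fst))

theorem primrec_requestSum {α : Type*} [Primcodable α] {r : α → ℕ → Option Request}
    (hr : Primrec₂ r) : Primrec₂ fun a n => requestSum (r a) n :=
  primrec_dyadicSum (primrec_requestWeight.comp₂ hr)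

theorem primrecRel_isGoodStage (he : Primrec e) (hE : PrimrecRel E) :
    PrimrecRel (IsGoodStage e E N b) := by
  have hlen : Primrec fun x : List Bool × ℕ => x.1.length := Primrec.list_length.comp Primrec.fst
  have hsum : Primrec fun x : List Bool × ℕ => requestSum e x.2 :=
    (primrec_requestSum (he.comp Primrec.snd).to₂).comp (Primrec.const ()) Primrec.snd
  have hselect : Primrec₂ fun (x : List Bool × ℕ) i =>
      select (survivors E x.1.length x.2) (e i) :=
    ((primrec_select_survivors hE).comp (Primrec.pair
      ((Primrec.pair hlen Primrec.snd).comp Primrec.fst) (he.comp Primrec.snd))).to₂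
  have hsurvivors : Primrec fun x : List Bool × ℕ =>
      requestSum (fun i => select (survivors E x.1.length x.2) (e i)) x.2 :=
    (primrec_requestSum hselect).comp Primrec.id Primrec.snd
  have hval : Primrec fun x : List Bool × ℕ => N * 2 ^ x.1.length + binVal x.1 :=
    Primrec.nat_add.comp (Primrec.nat_mul.comp (Primrec.const N) (primrec_two_pow.comp hlen))
      (primrec_binVal.comp Primrec.fst)
  have hlow : PrimrecRel fun (σ : List Bool) u =>
      dyadic (N * 2 ^ σ.length + binVal σ, σ.length) ≤
        dyadic (dyadicAdd (requestSum e u) (1, σ.length)) :=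
    primrecRel_dyadic_le.comp (Primrec.pair hval hlen)
      (primrec_dyadicAdd.comp hsum (Primrec.pair (Primrec.const 1) hlen))
  have hhigh : PrimrecRel fun (σ : List Bool) u =>
      dyadic (requestSum (fun i => select (survivors E σ.length u) (e i)) u) ≤
        dyadic (2 ^ b, σ.length) :=
    primrecRel_dyadic_le.comp hsurvivors (Primrec.pair (Primrec.const (2 ^ b)) hlen)
  refine (PrimrecPred.and hlow hhigh).of_eq fun x => ?_
  beta_reduce
  rw [dyadic_dyadicAdd, dyadic_one, dyadic_mk (2 ^ b), Nat.cast_pow, Nat.cast_ofNat,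
    IsGoodStage]

theorem rePred_mem_eligible (he : Primrec e) (hE : PrimrecRel E) :
    REPred fun x : List Bool × ℕ => x.2 ∈ eligible e E N b x.1 := by
  have hsum : Primrec (requestSum e) :=
    (primrec_requestSum (he.comp Primrec.snd).to₂).comp (Primrec.const ()) Primrec.id
  have hlen : Primrec fun x : (List Bool × ℕ) × ℕ => x.1.1.length :=
    Primrec.list_length.comp (Primrec.fst.comp Primrec.fst)
  have hindex : Primrec fun x : (List Bool × ℕ) × ℕ => x.1.2 := Primrec.snd.comp Primrec.fst
  refine rePred_exists (PrimrecPred.computablePred ?_)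
  refine PrimrecPred.and ((primrecRel_isLeast (primrecRel_isGoodStage he hE)).comp
    (Primrec.fst.comp Primrec.fst) Primrec.snd) (PrimrecPred.and ?_ ?_)
  · exact Primrec.eq.comp ((primrec_select_survivors hE).comp
      (Primrec.pair (Primrec.pair hlen Primrec.snd) (he.comp hindex))) (he.comp hindex)
  · refine (primrecRel_dyadic_le.comp (hsum.comp (Primrec.succ.comp hindex))
      (primrec_dyadicAdd.comp (hsum.comp Primrec.snd)
        (Primrec.pair (Primrec.const 2) hlen))).of_eq fun x => ?_
    rw [dyadic_dyadicAdd, dyadic_mk 2, Nat.cast_ofNat]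

theorem tsum_eligible_le (e : ℕ → Option Request) (E : ℕ × List Bool → ℕ → Prop) (N b : ℕ)
    (σ : List Bool) :
    ∑' j : eligible e E N b σ, dyadic (requestWeight (e j)) ≤ 2 ^ (b + 2) * 2⁻¹ ^ σ.length := by
  by_cases hgood : ∃ u, IsLeast {v | IsGoodStage e E N b σ v} u
  swap
  · have hempty : eligible e E N b σ = ∅ :=
      Set.eq_empty_of_forall_notMem fun j ⟨u, hu, _⟩ => hgood ⟨u, hu⟩
    simp [hempty]
  obtain ⟨u, hu⟩ := hgood
  set v : ℕ → ℝ≥0∞ := fun j => dyadic (requestWeight (select (survivors E σ.length u) (e j)))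
    with hv
  have hmem {j : ℕ} (hj : j ∈ eligible e E N b σ) : dyadic (requestWeight (e j)) = v j ∧
      dyadic (requestSum e (j + 1)) ≤ dyadic (requestSum e u) + 2 * 2⁻¹ ^ σ.length := by
    obtain ⟨u', hu', hselect, hsum⟩ := hj
    obtain rfl := hu'.unique hu
    exact ⟨by simp only [hv, hselect], hsum⟩
  calc ∑' j : eligible e E N b σ, dyadic (requestWeight (e j))
      = ∑' j : eligible e E N b σ, v j := tsum_congr fun j => (hmem j.2).1
    _ ≤ ∑ j ∈ Finset.range u, v j + 2 * 2⁻¹ ^ σ.length := by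
        refine tsum_le_sum_range_add (w := fun j => dyadic (requestWeight (e j)))
          (fun j => dyadic_requestWeight_select_le _ _) ?_ fun j hj => ?_
        · rw [← dyadic_dyadicSum, dyadic_eq_ofReal]
          exact ENNReal.ofReal_ne_top
        · rw [← dyadic_dyadicSum, ← dyadic_dyadicSum]
          exact (hmem hj).2
    _ ≤ 2 ^ b * 2⁻¹ ^ σ.length + 2 * 2⁻¹ ^ σ.length := by
        gcongr
        rw [hv, ← dyadic_dyadicSum]
        exact hu.1.2
    _ ≤ 2 ^ (b + 2) * 2⁻¹ ^ σ.length := by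
        rw [← add_mul]
        gcongr
        have hpow : 2 ^ b + 2 ≤ 2 ^ (b + 2) := by
          rw [pow_add]
          linarith [Nat.one_le_two_pow (n := b)]
        exact_mod_cast hpow

end GoodStages

section DeepSequences

variable {A : ℕ → Set (List Bool)} {E : ℕ × List Bool → ℕ → Prop} {e : ℕ → Option Request}

theorem tendsto_tsum_select_survivors (hmono : ∀ p, Monotone (E p))
    (hE : ∀ p : ℕ × List Bool, p.2 ∉ A p.1 ↔ ∃ u, E p u)
    (hsum : ∑' i, dyadic (requestWeight (e i)) ≠ ∞) (n : ℕ) :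
    Filter.Tendsto (fun u => ∑' i, dyadic (requestWeight (select (survivors E n u) (e i))))
      Filter.atTop (𝓝 (∑' i, dyadic (requestWeight (select (A n) (e i))))) := by
  refine tendsto_tsum_of_dominated hsum (fun _ _ => dyadic_requestWeight_select_le _ _) fun i => ?_
  refine tendsto_const_nhds.congr' ?_
  rcases e i with _ | q
  · exact Filter.Eventually.of_forall fun u => rfl
  by_cases hq : q.2 ∈ A n
  · refine Filter.Eventually.of_forall fun u => ?_
    beta_reduce
    rw [select_some_of_mem hq, select_some_of_mem
      (mem_survivors.2 fun hu => (hE (n, q.2)).2 ⟨u, hu⟩ hq)]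
  · obtain ⟨u, hu⟩ := (hE (n, q.2)).1 hq
    filter_upwards [Filter.eventually_ge_atTop u] with v hv
    rw [select_some_of_notMem hq, select_some_of_notMem
      fun h => mem_survivors.1 h (hmono _ hv hu)]

theorem exists_isGoodStage {U : List Bool →. List Bool} (he : IsDescriptionSequence U e)
    (hmono : ∀ p, Monotone (E p)) (hE : ∀ p : ℕ × List Bool, p.2 ∉ A p.1 ↔ ∃ u, E p u) {b n : ℕ}
    (hA : ∑' i, dyadic (requestWeight (select (A n) (e i))) < 2 ^ b * 2⁻¹ ^ n) :
    ∃ u, IsGoodStage e E ⌊omegaReal U⌋₊ b (restrict (omega U) n) u := by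
  have hfin : ∑' i, dyadic (requestWeight (e i)) ≠ ∞ := he.tsum_eq ▸ ENNReal.ofReal_ne_top
  have homega : ∀ᶠ u in Filter.atTop,
      ∑' i, dyadic (requestWeight (e i)) ≤ dyadic (requestSum e u) + 2⁻¹ ^ n := by
    have hlim := (tendsto_dyadic_dyadicSum fun i => requestWeight (e i)).add
      (tendsto_const_nhds (x := (2 : ℝ≥0∞)⁻¹ ^ n))
    filter_upwards [hlim.eventually_const_lt (ENNReal.lt_add_right hfin (by simp))] with u hu
      using hu.le
  have hsurvivors := (tendsto_tsum_select_survivors hmono hE hfin n).eventually_lt_const hA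
  obtain ⟨u, hu, hu'⟩ := (homega.and hsurvivors).exists
  rw [he.tsum_eq] at hu
  refine ⟨u, ?_, ?_⟩ <;> rw [length_restrict]
  · exact (dyadic_floor_omegaReal U n).1.trans hu
  · exact (dyadic_dyadicSum_le_tsum _ u).trans hu'.le

theorem mem_eligible {U : List Bool →. List Bool} (he : IsDescriptionSequence U e)
    (hE : ∀ p : ℕ × List Bool, p.2 ∉ A p.1 ↔ ∃ u, E p u) {b n j : ℕ} {q : Request}
    (hgood : ∃ u, IsGoodStage e E ⌊omegaReal U⌋₊ b (restrict (omega U) n) u)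
    (hj : e j = some q) (hq : q.2 ∈ A n) :
    j ∈ eligible e E ⌊omegaReal U⌋₊ b (restrict (omega U) n) := by
  classical
  have hu := Nat.isLeast_find hgood
  set u := Nat.find hgood
  have hstage := hu.1.1
  refine ⟨u, hu, ?_, ?_⟩ <;> rw [length_restrict] at *
  · rw [hj, select_some_of_mem (mem_survivors.2 fun hEu => (hE (n, q.2)).2 ⟨u, hEu⟩ hq)]
  · calc dyadic (requestSum e (j + 1)) ≤ ENNReal.ofReal (omegaReal U) :=
          he.tsum_eq ▸ dyadic_dyadicSum_le_tsum _ _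
      _ ≤ dyadic (⌊omegaReal U⌋₊ * 2 ^ n + binVal (restrict (omega U) n), n) + 2⁻¹ ^ n :=
          (dyadic_floor_omegaReal U n).2
      _ ≤ dyadic (requestSum e u) + 2⁻¹ ^ n + 2⁻¹ ^ n := by gcongr
      _ = dyadic (requestSum e u) + 2 * 2⁻¹ ^ n := by rw [add_assoc, two_mul]

theorem IsUniversalMachine.exists_sub_le_mutualInfo_omega {U : List Bool →. List Bool}
    (hU : IsUniversalMachine U) {pair : List Bool × List Bool ≃ List Bool}
    (hpair : Computable pair) {m : List Bool → ℝ≥0∞} (hm : IsUniversalSemimeasureIn ∅ m)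
    (hA : REPred fun p : ℕ × List Bool => p.2 ∉ A p.1)
    (hdeep : ∀ n, weight m (A n) < 2⁻¹ ^ n) :
    ∃ c : ℕ, ∀ n, ∀ τ ∈ A n, (n : ℤ) - c ≤ mutualInfo U pair (restrict (omega U) n) τ := by
  obtain ⟨e, he⟩ := hU.1.exists_isDescriptionSequence
  obtain ⟨E, hEprim, hmono, hE⟩ := exists_primrecRel_stages hA
  obtain ⟨b, hb⟩ := hm.exists_tsum_select_le he.primrec (he.tsum_le_one hU.1)
  have hgood (n : ℕ) : ∃ u, IsGoodStage e E ⌊omegaReal U⌋₊ b (restrict (omega U) n) u := by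
    refine exists_isGoodStage he hmono hE ((hb (A n)).trans_lt ?_)
    exact (ENNReal.mul_lt_mul_iff_right (by simp) (by simp)).2 (hdeep n)
  obtain ⟨c, hc⟩ := hU.exists_sub_le_mutualInfo he hpair Computable.list_length
    (rePred_mem_eligible he.primrec hEprim) (tsum_eligible_le e E ⌊omegaReal U⌋₊ b)
  refine ⟨c, fun n τ hτ => ?_⟩
  obtain ⟨p, hp, hpK⟩ := hU.exists_shortest_program τ
  obtain ⟨j, hj⟩ := he.exists_index p τ hp
  rw [hpK] at hj
  have h := hc (restrict (omega U) n) τ j (mem_eligible he hE (hgood n) hj hτ) hj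
  rwa [length_restrict] at h

end DeepSequences

/-! ### Information between sequences -/

theorem computableIn_restrict (X : ℕ → Bool) : ComputableIn (oracle X) (restrict X) := by
  let append (k : ℕ) : ℕ := Encodable.encode
    ((Encodable.decode (α := List Bool) k.unpair.1).getD [] ++ [decide (k.unpair.2 = 1)])
  have happend : Nat.Primrec append := by
    refine Primrec.nat_iff.1 (Primrec.encode.comp (Primrec.list_append.comp ?_ ?_))
    · exact Primrec.option_getD.comp (Primrec.decode.comp (Primrec.fst.comp Primrec.unpair))
        (Primrec.const [])
    · exact Primrec.list_cons.comp (PrimrecPred.decide (Primrec.eq.comp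
        (Primrec.snd.comp Primrec.unpair) (Primrec.const 1))) (Primrec.const [])
  have hquery : Nat.RecursiveIn (oracle X) fun n => Part.some (X n).toNat := .oracle _ rfl
  have hrec := Nat.RecursiveIn.prec
    ((Nat.Primrec.const (Encodable.encode ([] : List Bool))).recursiveIn (O := oracle X))
    (.comp (happend.recursiveIn (O := oracle X))
      (.pair (.comp .right .right) (.comp hquery (.comp .left .right))))
  refine (Nat.RecursiveIn.comp hrec (.pair ((Nat.Primrec.const 0).recursiveIn (O := oracle X))
    Nat.Primrec.id.recursiveIn)).of_eq fun n => ?_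
  simp only [Part.coe_some, id, Part.map_eq_map, Part.map_some, Seq.seq,
    Part.bind_eq_bind, Part.bind_some, Nat.unpair_pair, Encodable.decode_nat]
  induction n with
  | zero => rfl
  | succ n ih =>
    simp only [ih, Part.bind_some, restrict_succ]
    simp [append, Encodable.encodek]

theorem computableIn_comp_oracle {α β γ δ : Type*} [Primcodable α] [Primcodable β] [Primcodable γ]
    [Primcodable δ] {O : Set (ℕ →. ℕ)} {h : α × γ → δ} {G : β → γ} {N : α → β}
    (hh : Computable h) (hG : ComputableIn O G) (hN : Computable N) :
    ComputableIn O fun a => h (a, G (N a)) := by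
  refine (Nat.RecursiveIn.comp (hh.computableIn (O := O)) (Nat.RecursiveIn.pair
    Nat.Primrec.id.recursiveIn (Nat.RecursiveIn.comp hG (hN.computableIn (O := O))))).of_eq
    fun n => ?_
  cases hn : Encodable.decode (α := α) n <;> simp [hn, Seq.seq]

/-- The weight `2 ^ (-(j + 1))` that the string `X ↾ g j` receives in the semi-measure concentrated
on these prefixes of `X`, coded as a dyadic rational. The oracle `X` enters only through the prefix
`ρ` of `X` of the same length as `σ`. -/
def prefixWeight (g : ℕ → ℕ) (ρ σ : List Bool) (j : ℕ) : ℕ × ℕ :=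
  if g j = σ.length ∧ ρ = σ then (1, j + 1) else (0, 0)

section Prefixes

variable {g : ℕ → ℕ}

theorem restrict_eq_iff (X : ℕ → Bool) (n : ℕ) (σ : List Bool) :
    restrict X n = σ ↔ n = σ.length ∧ restrict X σ.length = σ := by
  constructor
  · rintro rfl
    rw [length_restrict]
    exact ⟨rfl, rfl⟩
  · rintro ⟨rfl, h⟩
    exact h

theorem dyadic_prefixWeight (X : ℕ → Bool) (σ : List Bool) (j : ℕ) :
    dyadic (prefixWeight g (restrict X σ.length) σ j) =
      if restrict X (g j) = σ then 2⁻¹ ^ (j + 1) else 0 := by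
  simp only [prefixWeight, ← restrict_eq_iff]
  split_ifs
  · exact dyadic_one _
  · exact dyadic_zero

theorem computable_prefixWeight (hg : Computable g) :
    Computable₂ fun (x : List Bool × List Bool) j => prefixWeight g x.1 x.2 j := by
  have hite : Primrec₂ fun (x : List Bool × List Bool) (y : ℕ × ℕ) =>
      if y.1 = x.2.length ∧ x.1 = x.2 then (1, y.2 + 1) else (0, 0) :=
    Primrec.ite
      (PrimrecPred.and
        (Primrec.eq.comp (Primrec.fst.comp Primrec.snd)
          (Primrec.list_length.comp (Primrec.snd.comp Primrec.fst)))
        (Primrec.eq.comp (Primrec.fst.comp Primrec.fst) (Primrec.snd.comp Primrec.fst)))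
      (Primrec.pair (Primrec.const 1) (Primrec.succ.comp (Primrec.snd.comp Primrec.snd)))
      (Primrec.const (0, 0))
  exact hite.to_comp.comp Computable.fst
    (Computable.pair (hg.comp Computable.snd) Computable.snd)

theorem isSemimeasureIn_tsum_prefixWeight (X : ℕ → Bool) (hg : Computable g) :
    IsSemimeasureIn (oracle X) fun σ =>
      ∑' j, dyadic (prefixWeight g (restrict X σ.length) σ j) := by
  constructor
  · simp only [dyadic_prefixWeight]
    rw [ENNReal.tsum_comm]
    simp only [eq_comm (a := restrict X _), tsum_ite_eq]
    exact tsum_two_inv_pow_succ.le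
  · refine ⟨fun σ => dyadicSum (prefixWeight g (restrict X σ.length) σ), ?_, fun σ =>
      ⟨monotone_dyadic_dyadicSum _, tendsto_dyadic_dyadicSum _⟩⟩
    have hweight : Computable₂ fun (x : (List Bool × ℕ) × List Bool) j =>
        prefixWeight g x.2 x.1.1 j :=
      ((computable_prefixWeight hg).comp
        (Computable.pair (Computable.snd.comp Computable.fst)
          (Computable.fst.comp (Computable.fst.comp Computable.fst))) Computable.snd).to₂
    have hsum : Computable fun x : (List Bool × ℕ) × List Bool =>
        dyadicSum (prefixWeight g x.2 x.1.1) x.1.2 :=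
      (computable_dyadicSum hweight).comp Computable.id (Computable.snd.comp Computable.fst)
    have hlength : Computable fun p : List Bool × ℕ => p.1.length :=
      Computable.list_length.comp Computable.fst
    exact (computableIn_comp_oracle hsum (computableIn_restrict X) hlength :)

theorem IsUniversalSemimeasureIn.exists_two_inv_pow_le {X : ℕ → Bool} {m : List Bool → ℝ≥0∞}
    (hm : IsUniversalSemimeasureIn (oracle X) m) (hg : Computable g) :
    ∃ c : ℝ≥0, ∀ j, (2 : ℝ≥0∞)⁻¹ ^ (j + 1) ≤ c * m (restrict X (g j)) := by
  obtain ⟨c, hc⟩ := hm.2 _ (isSemimeasureIn_tsum_prefixWeight X hg)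
  refine ⟨c, fun j => le_trans ?_ (hc (restrict X (g j)))⟩
  refine le_of_eq_of_le ?_ (ENNReal.le_tsum j)
  rw [dyadic_prefixWeight, if_pos rfl]

end Prefixes

theorem mutualInfoSeq_eq_top {U : List Bool →. List Bool}
    {pair : List Bool × List Bool ≃ List Bool} {X Y : ℕ → Bool} {mX mY : List Bool → ℝ≥0∞}
    (hX : IsUniversalSemimeasureIn (oracle X) mX) (hY : IsUniversalSemimeasureIn (oracle Y) mY)
    {g h : ℕ → ℕ} (hg : Computable g) (hh : Computable h) {c : ℕ}
    (hI : ∀ n : ℕ, (n : ℤ) - c ≤ mutualInfo U pair (restrict X (g n)) (restrict Y (h n))) :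
    mutualInfoSeq U pair mX mY = ⊤ := by
  let index (j : ℕ) : ℕ := 3 * j + (2 + c)
  have hindex : Computable index := (Primrec.nat_add.comp
    (Primrec.nat_mul.comp (Primrec.const 3) Primrec.id) (Primrec.const (2 + c))).to_comp
  obtain ⟨c₁, hc₁⟩ := hX.exists_two_inv_pow_le (hg.comp hindex)
  obtain ⟨c₂, hc₂⟩ := hY.exists_two_inv_pow_le (hh.comp hindex)
  let term (p : List Bool × List Bool) : ℝ≥0∞ :=
    mX p.1 * mY p.2 * (2 : ℝ≥0∞) ^ mutualInfo U pair p.1 p.2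
  have hterm (j : ℕ) : (2 : ℝ≥0∞) ^ j ≤ c₁ * c₂ * ∑' p, term p := by
    set σ := restrict X (g (index j))
    set τ := restrict Y (h (index j))
    have hpow : (2 : ℝ≥0∞) ^ (3 * j + 2) ≤ 2 ^ mutualInfo U pair σ τ := by
      rw [← zpow_natCast]
      refine ENNReal.zpow_le_of_le one_le_two (le_trans ?_ (hI (index j)))
      simp only [index]
      omega
    calc (2 : ℝ≥0∞) ^ j
        = 2 ^ (j + 1) * 2⁻¹ ^ (j + 1) * (2 ^ (j + 1) * 2⁻¹ ^ (j + 1)) * 2 ^ j := by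
          rw [two_pow_mul_two_inv_pow, one_mul, one_mul]
      _ = 2⁻¹ ^ (j + 1) * 2⁻¹ ^ (j + 1) * 2 ^ (3 * j + 2) := by ring
      _ ≤ (c₁ * mX σ) * (c₂ * mY τ) * 2 ^ mutualInfo U pair σ τ := by
          gcongr
          exacts [hc₁ j, hc₂ j]
      _ = c₁ * c₂ * term (σ, τ) := by ring
      _ ≤ c₁ * c₂ * ∑' p, term p := by gcongr; exact ENNReal.le_tsum _
  have htop : ∑' p, term p = ⊤ := by
    by_contra hne
    obtain ⟨j, hj⟩ := ENNReal.exists_nat_gt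
      (ENNReal.mul_ne_top (a := c₁ * c₂) (by finiteness) hne)
    exact (hj.trans (by exact_mod_cast j.lt_two_pow_self)).not_ge (hterm j)
  rw [mutualInfoSeq, htop, ENNReal.log_top]
  exact EReal.top_div_of_pos_ne_top (by exact_mod_cast Real.log_pos one_lt_two)
    (EReal.coe_ne_top _)

theorem sub_mul_logb_le (n c : ℕ) : (n : ℝ) - c * Real.logb 2 (n + 2) ≤ n - c := by
  have hlog : 1 ≤ Real.logb 2 (n + 2) := by
    rw [Real.le_logb_iff_rpow_le one_lt_two (by positivity), Real.rpow_one]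
    linarith [n.cast_nonneg (α := ℝ)]
  gcongr
  exact le_mul_of_one_le_right c.cast_nonneg hlog

end AlgInfo

end

theorem mainTheorem12_general
    (U : List Bool →. List Bool) (hU : AlgInfo.IsUniversalMachine U)
    (pair : List Bool × List Bool ≃ List Bool) (hpair : Computable pair)
    (m : List Bool → ENNReal) (hm : AlgInfo.IsUniversalSemimeasureIn ∅ m)
    (C : Set (ℕ → Bool)) (hC : AlgInfo.IsPi01 C)
    (f : ℕ → ℕ) (hf : Computable f)
    (hdeep : ∀ n : ℕ,
      AlgInfo.weight m (AlgInfo.level (AlgInfo.canonicalTree C) (f n)) < (2 : ENNReal)⁻¹ ^ n) :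
    (∃ c : ℕ, ∀ Y ∈ C, ∀ n : ℕ,
      (n : ℤ) - c ≤ AlgInfo.mutualInfo U pair (AlgInfo.restrict (AlgInfo.omega U) n)
        (AlgInfo.restrict Y (f n))) ∧
    ∀ Y ∈ C, ∀ mΩ mY : List Bool → ENNReal,
      AlgInfo.IsUniversalSemimeasureIn (AlgInfo.oracle (AlgInfo.omega U)) mΩ →
      AlgInfo.IsUniversalSemimeasureIn (AlgInfo.oracle Y) mY →
      AlgInfo.mutualInfoSeq U pair mΩ mY = ⊤ := by
  obtain ⟨c, hc⟩ :=
    hU.exists_sub_le_mutualInfo_omega hpair hm (hC.rePred_notMem_level hf) hdeep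
  have hinfo : ∀ Y ∈ C, ∀ n : ℕ, (n : ℤ) - c ≤ AlgInfo.mutualInfo U pair
      (AlgInfo.restrict (AlgInfo.omega U) n) (AlgInfo.restrict Y (f n)) := fun Y hY n =>
    hc n _ ⟨⟨Y, hY, AlgInfo.isInitial_restrict Y _⟩, AlgInfo.length_restrict Y _⟩
  exact ⟨⟨c, hinfo⟩, fun Y hY _ _ hΩ hmY =>
    AlgInfo.mutualInfoSeq_eq_top hΩ hmY Computable.id hf (hinfo Y hY)⟩

theorem mainTheorem12
    (U : List Bool →. List Bool) (hU : AlgInfo.IsUniversalMachine U)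
    (pair : List Bool × List Bool ≃ List Bool) (hpair : Computable pair)
    (m : List Bool → ENNReal) (hm : AlgInfo.IsUniversalSemimeasureIn ∅ m)
    (C : Set (ℕ → Bool)) (hC : AlgInfo.IsPi01 C)
    (f : ℕ → ℕ) (hf : Computable f) (hford : AlgInfo.IsOrder f)
    (hdeep : ∀ n : ℕ,
      AlgInfo.weight m (AlgInfo.level (AlgInfo.canonicalTree C) (f n)) < (2 : ENNReal)⁻¹ ^ n) :
    (∃ c : ℝ, ∀ Y ∈ C, ∀ n : ℕ,
      (n : ℝ) - c * Real.logb 2 (n + 2) ≤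
        (AlgInfo.mutualInfo U pair (AlgInfo.restrict (AlgInfo.omega U) n)
          (AlgInfo.restrict Y (f n)) : ℝ)) ∧
    ∀ Y ∈ C, ∀ mΩ mY : List Bool → ENNReal,
      AlgInfo.IsUniversalSemimeasureIn (AlgInfo.oracle (AlgInfo.omega U)) mΩ →
      AlgInfo.IsUniversalSemimeasureIn (AlgInfo.oracle Y) mY →
      AlgInfo.mutualInfoSeq U pair mΩ mY = ⊤ := by
  obtain ⟨⟨c, hc⟩, htop⟩ := mainTheorem12_general U hU pair hpair m hm C hC f hf hdeep
  exact ⟨⟨c, fun Y hY n =>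
    (AlgInfo.sub_mul_logb_le n c).trans (by exact_mod_cast hc Y hY n)⟩, htop⟩
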